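/- Let $n\ge 2$, let $V$ be an $n$-dimensional real affine space, and let $E\subset V$ be a finite set of $N>n$ points. Let $\Sigma$ be the set of nondegenerate $n$-simplices with vertices in $E$, let $P=\operatorname{conv}(E)$, and let $\Gamma$ be the set of chambers, i.e. of closures of the connected components of $P\setminus\bigcup_{\sigma\in\Sigma}\partial\sigma$. Let $A=(a_{\sigma,\gamma})_{\sigma\in\Sigma,\gamma\in\Gamma}$ be the incidence matrix over a field $K$ of characteristic $0$: $a_{\sigma,\gamma}=1$ if $\gamma\subset\sigma$, and $a_{\sigma,\gamma}=0$ otherwise. Let $V_\Sigma$ be the space spanned by the rows of $A$. **The algorithm.** Order the points of $E$ as $e_1,\dots,e_N$ so that $\operatorname{conv}(e_1,\dots,e_k)\cap\operatorname{conv}(e_{k+1},\dots,e_N)=\emptyset$ for all $k$. The algorithm produces $B=\bigcup_k B_k\subset\Sigma$ as follows. * If $n=2$, then $B_k$ is the set of all triangles $\sigma(e_k,e_i,e_j)$ with $i,j>k$ such that the rays from $e_k$ through $e_i$ and $e_j$ are distinct and neighbouring (no $e_m$ with $m>k$ lies strictly inside the angle between them), and $e_i$, $e_j$ are the points of $E$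 nearest to $e_k$ on these rays. * If $n>2$, choose for each $k$ a hyperplane $H_k$ strictly separating $\{e_1,\dots,e_k\}$ from $\{e_{k+1},\dots,e_N\}$. Let $E_k\subset H_k$ be the set of the points at which the open segments $(e_k,e_i)$, $i>k$, meet $H_k$. Let $\tilde B_k$ be a set of $(n-1)$-simplices produced by the algorithm in $H_k$ from the set $E_k$ (with its own choice of an ordering and of hyperplanes). Then $B_k=\{\mu(\tau):\tau\in\tilde B_k\}$, where for $\tau=\sigma(p_1,\dots,p_n)$ one puts $\mu(\tau)=\sigma(e_k,e_{i_1},\dots,e_{i_n})$, and $e_{i_j}$ is the point of $E$ nearest to $e_k$ on the ray from $e_k$ through $p_j$. **The system $F$.** For each set $S\subseteq E$ of $n+2$ points that contains $n+1$ affinely independent points let $f_S$ be the set of all $\sigma\in\Sigma$ with vertices in $S$. Let $F$ be the set of all these $f_S$. **Geometrical bases.** For $B\subset\Sigma$, a simplex $\sigma\notin B$ is expressed in one step in terms of $B$ using $F$ if there is $f\in F$ with $\sigma\in f$ and $f\setminus\{\sigma\}\subseteq B$. It is expressed in $k$ steps if there is a sequence $\sigma_1,\dots,\sigma_k=\sigma$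 in $\Sigma$ such that each $\sigma_i$ is expressed in one step in terms of $B\cup\{\sigma_1,\dots,\sigma_{i-1}\}$. The set $B$ is a geometrical basis of $V_\Sigma$ with respect to $F$ if the rows of $A$ indexed by $B$ form a basis of $V_\Sigma$, and every $\sigma\in\Sigma\setminus B$ is expressed in $k$ steps in terms of $B$ using $F$ for some $k$. **Theorem.** For every choice of the orderings and of the hyperplanes, the set $B$ produced by the algorithm is a geometrical basis of $V_\Sigma$ with respect to $F$. -/

import Mathlib

open Set Module

namespace SimplexBasis

variable {V : Type*} [NormedAddCommGroup V] [NormedSpace ℝ V]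

/-! ### Simplices, chambers and the incidence matrix -/

/-- The set `Σ` of nondegenerate `n`-simplices with vertices in `E`. A simplex is recorded by its
set of `n + 1` affinely independent vertices; the simplex itself is `convexHull ℝ σ`. -/
def simplices (n : ℕ) (E : Set V) : Set (Finset V) :=
  {σ | (σ : Set V) ⊆ E ∧ σ.card = n + 1 ∧ AffineIndependent ℝ ((↑) : σ → V)}

/-- The union of the boundaries of all simplices of `Σ`. -/
def walls (n : ℕ) (E : Set V) : Set V :=
  ⋃ σ ∈ simplices n E, frontier (convexHull ℝ (σ : Set V))

/-- `P` without the boundaries of all simplices, where `P = conv(E)`. -/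
def chamberRegion (n : ℕ) (E : Set V) : Set V :=
  convexHull ℝ E \ walls n E

/-- The set `Γ` of chambers: the closures of the connected components of `chamberRegion n E`. -/
def chambers (n : ℕ) (E : Set V) : Set (Set V) :=
  {γ | ∃ x ∈ chamberRegion n E, γ = closure (connectedComponentIn (chamberRegion n E) x)}

open Classical in
/-- The incidence matrix: the entry at `(σ, γ)` is `1` if `γ ⊆ σ` and `0` otherwise. -/
noncomputable def incidence (K : Type*) [Field K] (n : ℕ) (E : Set V) :
    Matrix (simplices n E) (chambers n E) K :=
  Matrix.of fun σ γ => if (γ : Set V) ⊆ convexHull ℝ ((σ : Finset V) : Set V) then 1 else 0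

/-- The space generated by the rows of the incidence matrix. -/
def rowSpace (K : Type*) [Field K] (n : ℕ) (E : Set V) : Submodule K (chambers n E → K) :=
  Submodule.span K (range (incidence K n E).row)

/-- `B ⊆ Σ` is a basis of simplices: the rows of the incidence matrix indexed by the elements of
`B` are linearly independent and span the whole row space. -/
structure IsBasisOfSimplices (K : Type*) [Field K] (n : ℕ) (E : Set V) (B : Set (Finset V)) :
    Prop where
  subset : B ⊆ simplices n E
  linearIndep : LinearIndepOn K (incidence K n E).row {σ : simplices n E | (σ : Finset V) ∈ B}
  span_eq : Submodule.span K
    ((incidence K n E).row '' {σ : simplices n E | (σ : Finset V) ∈ B}) = rowSpace K n E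

/-! ### Geometrical bases -/

/-- The family of all simplices of `Σ` with vertices in `S`. -/
def simplicesOn (n : ℕ) (E : Set V) (S : Finset V) : Set (Finset V) :=
  {σ | σ ∈ simplices n E ∧ σ ⊆ S}

/-- The system `F` of all families `simplicesOn n E S`, where `S ⊆ E` consists of `n + 2` points
among which there are `n + 1` affinely independent ones. -/
def systemF (n : ℕ) (E : Set V) : Set (Set (Finset V)) :=
  {f | ∃ S : Finset V, (S : Set V) ⊆ E ∧ S.card = n + 2 ∧
    (∃ T ⊆ S, T.card = n + 1 ∧ AffineIndependent ℝ ((↑) : T → V)) ∧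
    f = simplicesOn n E S}

/-- `σ ∉ B` is expressed in one step in terms of `B` using `F`. -/
def ExpressedInOneStep (F : Set (Set (Finset V))) (B : Set (Finset V)) (σ : Finset V) : Prop :=
  σ ∉ B ∧ ∃ f ∈ F, σ ∈ f ∧ f \ {σ} ⊆ B

/-- `σ ∉ B` is expressed in `k` steps in terms of `B` using `F`: there are simplices
`s 1, …, s k = σ` such that each `s i` is expressed in one step in terms of
`B ∪ {s 1, …, s (i - 1)}`. -/
def ExpressedInSteps (n : ℕ) (E : Set V) (F : Set (Set (Finset V))) (B : Set (Finset V))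
    (k : ℕ) (σ : Finset V) : Prop :=
  σ ∉ B ∧ 1 ≤ k ∧ ∃ s : ℕ → Finset V, s k = σ ∧
    ∀ i ∈ Icc 1 k, s i ∈ simplices n E ∧ ExpressedInOneStep F (B ∪ s '' Ico 1 i) (s i)

/-- `B` is a geometrical basis with respect to the system `F`. -/
structure IsGeometricalBasis (K : Type*) [Field K] (n : ℕ) (E : Set V)
    (F : Set (Set (Finset V))) (B : Set (Finset V)) : Prop where
  basis : IsBasisOfSimplices K n E B
  expressed : ∀ σ ∈ simplices n E, σ ∉ B → ∃ k, ExpressedInSteps n E F B k σ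

/-! ### The algorithm -/

/-- The polytope `F_k = conv(e_1, …, e_k)` (indices in `Fin N`, the point `e k` is included). -/
def initialHull {N : ℕ} (e : Fin N → V) (k : Fin N) : Set V := convexHull ℝ (e '' Iic k)

/-- The polytope `P_k = conv(e_{k+1}, …, e_N)`. -/
def finalHull {N : ℕ} (e : Fin N → V) (k : Fin N) : Set V := convexHull ℝ (e '' Ioi k)

/-- `e` lists the points of `E` without repetition, and for every `k` the convex hull of the first
`k` points is disjoint from the convex hull of the remaining ones. -/
structure IsAdmissibleOrdering (E : Set V) {N : ℕ} (e : Fin N → V) : Prop where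
  injective : Function.Injective e
  range_eq : range e = E
  disjoint : ∀ k, Disjoint (initialHull e k) (finalHull e k)

/-- `H` (strictly) separates the sets `X` and `Y`. -/
def Separates (H : AffineSubspace ℝ V) (X Y : Set V) : Prop :=
  ∀ x ∈ X, ∀ y ∈ Y, H.SOppSide x y

/-- The ray from `x` through `p`, without its origin `x`. -/
def openRay (x p : V) : Set V := {y | ∃ t : ℝ, 0 < t ∧ y = AffineMap.lineMap x p t}

/-- `y` is the point of `E` nearest to `x` on the ray from `x` through `p`. -/
def IsNearestOnRay (E : Set V) (x p y : V) : Prop :=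
  y ∈ E ∧ y ∈ openRay x p ∧ ∀ z ∈ E, z ∈ openRay x p → dist x y ≤ dist x z

/-- In the plane: the edges from `e k` to `e i` and to `e j` (where `i, j > k`) are distinct
neighbours, that is, they lie on different rays and no edge from `e k` to a point `e m`, `m > k`,
lies strictly between them. -/
def AreNeighbourEdges {N : ℕ} (e : Fin N → V) (k i j : Fin N) : Prop :=
  k < i ∧ k < j ∧ e j ∉ openRay (e k) (e i) ∧
    ¬ ∃ m, k < m ∧ ∃ a b : ℝ, 0 < a ∧ 0 < b ∧
      e m - e k = a • (e i - e k) + b • (e j - e k)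

/-- In the plane: the set `B_k` of all triangles `e_k e_i e_j`, where the edges `(e_k, e_i)` and
`(e_k, e_j)` are neighbours and `e_i`, `e_j` are the points of `E` on them nearest to `e_k`. -/
def planeTriangles (E : Set V) {N : ℕ} (e : Fin N → V) (k : Fin N) : Set (Finset V) :=
  {σ | ∃ i j, AreNeighbourEdges e k i j ∧
    IsNearestOnRay E (e k) (e i) (e i) ∧ IsNearestOnRay E (e k) (e j) (e j) ∧
    (σ : Set V) = {e k, e i, e j}}

/-- The set `E_k` of the points at which the open segments `(e_k, e_i)`, `i > k`, meet `H`. -/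
def sectionPoints {N : ℕ} (e : Fin N → V) (k : Fin N) (H : AffineSubspace ℝ V) : Set V :=
  {p | p ∈ H ∧ ∃ i, k < i ∧ p ∈ openSegment ℝ (e k) (e i)}

/-- `σ = μ(τ)`: the vertices of `σ` are the apex `x` and, for every vertex `p` of `τ`, the point of
`E` nearest to `x` on the ray from `x` through `p`. -/
def IsMu (E : Set V) (x : V) (τ σ : Finset V) : Prop :=
  (σ : Set V) = insert x {y | ∃ p ∈ τ, IsNearestOnRay E x p y}

/-- `IsAlgorithmOutput d W E B`: the set `B` is obtained from the points `E` of the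
`d`-dimensional affine space `W` by the algorithm, for some run of it. The orderings and the
separating hyperplanes are free choices, at every level of the recursion. -/
inductive IsAlgorithmOutput :
    ℕ → AffineSubspace ℝ V → Set V → Set (Finset V) → Prop
  /-- The plane: `B` is the union of the sets `B_k` of triangles. -/
  | plane (W : AffineSubspace ℝ V) (E : Set V) (B : Set (Finset V))
      (hW : finrank ℝ W.direction = 2) (hEW : E ⊆ W)
      (N : ℕ) (e : Fin N → V) (he : IsAdmissibleOrdering E e)
      (hB : B = ⋃ k, planeTriangles E e k) :
      IsAlgorithmOutput 2 W E B
  /-- From dimension `d` to `d + 1`: for each `k` take a hyperplane `H k` of `W` that separates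
  `e_1, …, e_k` from `e_{k+1}, …, e_N`, run the algorithm in `H k` on the set `E_k`, and lift the
  resulting simplices by `μ`. -/
  | step (d : ℕ) (W : AffineSubspace ℝ V) (E : Set V) (B : Set (Finset V))
      (hW : finrank ℝ W.direction = d + 1) (hEW : E ⊆ W)
      (N : ℕ) (e : Fin N → V) (he : IsAdmissibleOrdering E e)
      (H : Fin N → AffineSubspace ℝ V) (hHW : ∀ k, H k ≤ W)
      (hH : ∀ k, finrank ℝ (H k).direction = d)
      (hsep : ∀ k, Separates (H k) (initialHull e k) (finalHull e k))
      (Bt : Fin N → Set (Finset V))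
      (hBt : ∀ k, IsAlgorithmOutput d (H k) (sectionPoints e k (H k)) (Bt k))
      (hB : B = ⋃ k, {σ | ∃ τ ∈ Bt k, IsMu E (e k) τ σ}) :
      IsAlgorithmOutput (d + 1) W E B

end SimplexBasis

namespace SimplexBasis

open scoped Classical

variable {V : Type*} [NormedAddCommGroup V] [NormedSpace ℝ V]

/-! Two facts carry the theorem. The first is a relation for each `S` of `n + 2` points in
`systemF`. Its affine dependencies form a line spanned by some `l`, and the nondegenerate simplices
on `S` are the sets `S.erase u` with `l u ≠ 0`. Writing a point `x` off the walls as a convex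
combination of `S` leaves at most a segment of weights, parallel to `l`. At one end of it exactly
one coordinate vanishes, and it has `l > 0`; at the other exactly one, with `l < 0`. Hence the
indicators of the simplices on `S`, with the signs of `l`, sum to zero
(`IsCircuit.sum_sign_eq_zero`). So expressing a simplex in steps also puts its row into the span of
the rows of `B`.

The second is an induction on dimension through `IsRelativeBasis`, which combines generation with
independence of indicators at generic points. Central projection from `e k` matches the simplices
with apex `e k` and later vertices, up to moving vertices along rays, with simplices of one
dimension less in a section.

Generation runs from the last point to the first: vertices are moved to the chosen points on their
rays (`IsApex.generated`), and relations of the section lift to relations with the apex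
(`IsApex.generated_liftSimplex`), the only other term being a simplex on later points. Independence
runs from the first point to the last. Near `e k` the simplices of the later `B_m` are absent and
the earlier coefficients are already zero, so only cones over simplices of the section remain
(`IsApex.coeff_eq_zero`). The induction starts with neighbouring points on a line, and the planar
rule is the lift of that case (`planeTriangles_eq`). -/

/-! ### Expressing simplices step by step -/

/-- The closure of `B` under expression in one step by means of the system `F`. -/
inductive Generated (F : Set (Set (Finset V))) (B : Set (Finset V)) : Finset V → Prop
  | base {σ : Finset V} (h : σ ∈ B) : Generated F B σ
  | step {σ : Finset V} {f : Set (Finset V)} (hf : f ∈ F) (hσ : σ ∈ f)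
      (h : ∀ τ ∈ f, τ ≠ σ → Generated F B τ) : Generated F B σ

theorem simplices_finite (n : ℕ) {E : Set V} (hE : E.Finite) : (simplices n E).Finite := by
  refine (hE.toFinset.powerset.finite_toSet).subset fun σ hσ => ?_
  simp only [Finset.coe_powerset, mem_preimage, mem_powerset_iff, Finite.coe_toFinset]
  exact hσ.1

theorem simplices_mono {n : ℕ} {E E' : Set V} (h : E ⊆ E') : simplices n E ⊆ simplices n E' :=
  fun _ hσ => ⟨hσ.1.trans h, hσ.2⟩

/-- A valid sequence never repeats a simplex, so its length is bounded and a longest one exists. It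
must contain every generated simplex outside `B`, since a missing one could be appended. Cutting it
off at `σ` gives the required steps. -/
theorem Generated.expressedInSteps {n : ℕ} {E : Set V} (hE : E.Finite) {B : Set (Finset V)}
    {σ : Finset V} (hσ : Generated (systemF n E) B σ) (hσB : σ ∉ B) :
    ∃ k, ExpressedInSteps n E (systemF n E) B k σ := by
  let Valid (m : ℕ) (s : ℕ → Finset V) : Prop := ∀ i ∈ Icc 1 m,
    s i ∈ simplices n E ∧ ExpressedInOneStep (systemF n E) (B ∪ s '' Ico 1 i) (s i)
  have bound : ∀ m, (∃ s, Valid m s) → m ≤ (simplices n E).ncard := by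
    rintro m ⟨s, hs⟩
    have hinj : InjOn s (Icc 1 m) := by
      have key : ∀ i ∈ Icc 1 m, ∀ j ∈ Icc 1 m, i < j → s i ≠ s j := fun i hi j hj hij h =>
        (hs j hj).2.1 (Or.inr ⟨i, ⟨hi.1, hij⟩, h⟩)
      intro i hi j hj h
      rcases lt_trichotomy i j with hij | hij | hij
      · exact absurd h (key i hi j hj hij)
      · exact hij
      · exact absurd h.symm (key j hj i hi hij)
    have := ncard_le_ncard_of_injOn s (fun i hi => (hs i hi).1) hinj (simplices_finite n hE)
    simpa [Set.ncard_eq_toFinset_card'] using this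
  have h0 : ∃ s, Valid 0 s := ⟨fun _ => ∅, fun i hi => by
    have h1 := hi.1; have h2 := hi.2; omega⟩
  obtain ⟨s, hs⟩ := Nat.findGreatest_spec (P := fun m => ∃ s, Valid m s)
    (Nat.zero_le (simplices n E).ncard) h0
  set m := Nat.findGreatest (fun m => ∃ s, Valid m s) (simplices n E).ncard with hm
  have hmax : ¬ ∃ s, Valid (m + 1) s := fun h => by
    have h1 : m + 1 ≤ m := Nat.le_findGreatest (bound _ h) h
    omega
  have hall : ∀ τ, Generated (systemF n E) B τ → τ ∈ B ∪ s '' Icc 1 m := by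
    intro τ hτ
    induction hτ with
    | base h => exact Or.inl h
    | @step σ f hf hσ h ih =>
      by_contra hnot
      apply hmax
      have hσ' : σ ∈ simplices n E := by
        obtain ⟨S, -, -, -, rfl⟩ := hf
        exact hσ.1
      refine ⟨Function.update s (m + 1) σ, fun i hi => ?_⟩
      have himg : ∀ j ≤ m + 1, Function.update s (m + 1) σ '' Ico 1 j = s '' Ico 1 j := by
        intro j hj
        refine image_congr fun l hl => Function.update_of_ne ?_ _ _
        have := hl.2
        omega
      rw [himg i hi.2]
      rcases Nat.lt_or_ge m i with hmi | hmi
      · obtain rfl : i = m + 1 := le_antisymm hi.2 hmi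
        rw [Function.update_self]
        have hIco : Ico 1 (m + 1) = Icc 1 m := by ext; simp
        rw [hIco]
        exact ⟨hσ', hnot, f, hf, hσ, fun τ hτ => ih τ hτ.1 hτ.2⟩
      · rw [Function.update_of_ne (by omega)]
        exact hs i ⟨hi.1, hmi⟩
  rcases hall σ hσ with h | ⟨k, hk, rfl⟩
  · exact absurd h hσB
  · exact ⟨k, hσB, hk.1, s, rfl, fun i hi => hs i ⟨hi.1, hi.2.trans hk.2⟩⟩

/-! ### Barycentric coordinates -/

/-- Weights are functions on all of `V`, so that combinations over different vertex sets can be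
compared and subtracted directly. -/
theorem affineIndependent_finset_iff (σ : Finset V) :
    AffineIndependent ℝ ((↑) : σ → V) ↔
      ∀ w : V → ℝ, ∑ v ∈ σ, w v = 0 → ∑ v ∈ σ, w v • v = 0 → ∀ v ∈ σ, w v = 0 := by
  rw [affineIndependent_iff]
  constructor
  · intro h w h1 h2 v hv
    refine h Finset.univ (fun v => w v) ?_ ?_ ⟨v, hv⟩ (Finset.mem_univ _)
    · rw [← h1]; exact Finset.sum_coe_sort σ w
    · rw [← h2]; exact Finset.sum_coe_sort σ (fun v => w v • v)
  · intro h s w h1 h2 e he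
    let w' : V → ℝ := fun v => if hv : v ∈ σ then (if (⟨v, hv⟩ : σ) ∈ s then w ⟨v, hv⟩ else 0) else 0
    have e1 : ∀ v : σ, w' v = if v ∈ s then w v else 0 := fun v => by simp [w']
    have he' : σ.attach ∩ s = s := by rw [← Finset.univ_eq_attach, Finset.univ_inter]
    have := h w' ?_ ?_ e e.2
    · rw [e1, if_pos he] at this
      exact this
    · rw [← Finset.sum_coe_sort σ w', ← h1]
      simp [e1, Finset.sum_ite_mem, he']
    · rw [← Finset.sum_coe_sort σ (fun v => w' v • v), ← h2]
      simp [e1, Finset.sum_ite_mem, ite_smul, he']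

theorem affineIndependent_weights_unique {σ : Finset V} (h : AffineIndependent ℝ ((↑) : σ → V))
    {w w' : V → ℝ} (h1 : ∑ v ∈ σ, w v = ∑ v ∈ σ, w' v)
    (h2 : ∑ v ∈ σ, w v • v = ∑ v ∈ σ, w' v • v) : ∀ v ∈ σ, w v = w' v := by
  intro v hv
  refine sub_eq_zero.mp ((affineIndependent_finset_iff σ).mp h (fun v => w v - w' v) ?_ ?_ v hv)
  · rw [Finset.sum_sub_distrib, h1, sub_self]
  · simp_rw [sub_smul]
    rw [Finset.sum_sub_distrib, h2, sub_self]

theorem exists_weights {n : ℕ} [FiniteDimensional ℝ V] (hV : finrank ℝ V = n) {σ : Finset V}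
    (hc : σ.card = n + 1) (h : AffineIndependent ℝ ((↑) : σ → V)) (x : V) :
    ∃ w : V → ℝ, ∑ v ∈ σ, w v = 1 ∧ ∑ v ∈ σ, w v • v = x ∧
      (x ∈ interior (convexHull ℝ (σ : Set V)) ↔ ∀ v ∈ σ, 0 < w v) := by
  let b : AffineBasis σ ℝ V := ⟨(↑), h, by
    rw [h.affineSpan_eq_top_iff_card_eq_finrank_add_one, hV, Fintype.card_coe, hc]⟩
  let w : V → ℝ := fun v => if hv : v ∈ σ then b.coord ⟨v, hv⟩ x else 0
  have e1 : ∀ v : σ, w v = b.coord v x := fun v => by simp [w]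
  have hr : range b = (σ : Set V) := by
    change range ((↑) : σ → V) = _
    simp
  refine ⟨w, ?_, ?_, ?_⟩
  · rw [← Finset.sum_coe_sort σ w]
    simp_rw [e1]
    exact b.sum_coord_apply_eq_one x
  · rw [← Finset.sum_coe_sort σ (fun v => w v • v)]
    simp_rw [e1]
    exact b.linear_combination_coord_eq_self x
  · rw [← hr, b.interior_convexHull]
    simp only [mem_ofPred_eq]
    exact ⟨fun H v hv => (e1 ⟨v, hv⟩).symm ▸ H ⟨v, hv⟩, fun H i => e1 i ▸ H i i.2⟩

theorem isClosed_convexHull_finset (σ : Finset V) : IsClosed (convexHull ℝ (σ : Set V)) :=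
  (σ.finite_toSet.isCompact_convexHull ℝ).isClosed

theorem weights_pos_of_notMem_walls {n : ℕ} [FiniteDimensional ℝ V] (hV : finrank ℝ V = n)
    {E : Set V} {σ : Finset V} (hσ : σ ∈ simplices n E) {x : V} (hx : x ∉ walls n E)
    (hxσ : x ∈ convexHull ℝ (σ : Set V)) :
    ∃ w : V → ℝ, (∀ v ∈ σ, 0 < w v) ∧ ∑ v ∈ σ, w v = 1 ∧ ∑ v ∈ σ, w v • v = x := by
  obtain ⟨w, h1, h2, h3⟩ := exists_weights hV hσ.2.1 hσ.2.2 x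
  refine ⟨w, h3.mp ?_, h1, h2⟩
  by_contra hint
  apply hx
  rw [walls, mem_iUnion₂]
  exact ⟨σ, hσ, (isClosed_convexHull_finset σ).frontier_eq ▸ ⟨hxσ, hint⟩⟩

/-- The hyperplanes spanned by the facets of the simplices. -/
def facetSpans (n : ℕ) (E : Set V) : Set (AffineSubspace ℝ V) :=
  {A | ∃ σ ∈ simplices n E, ∃ v ∈ σ, A = affineSpan ℝ ((σ.erase v : Finset V) : Set V)}

theorem facetSpans_finite (n : ℕ) {E : Set V} (hE : E.Finite) : (facetSpans n E).Finite := by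
  have : facetSpans n E = ⋃ σ ∈ simplices n E,
      (fun v => affineSpan ℝ ((σ.erase v : Finset V) : Set V)) '' (σ : Set V) := by
    ext A
    simp only [facetSpans, mem_ofPred_eq, mem_iUnion, mem_image, Finset.mem_coe, exists_prop,
      eq_comm]
  rw [this]
  exact (simplices_finite n hE).biUnion fun σ _ => σ.finite_toSet.image _

theorem facetSpans_lt_top {n : ℕ} {E : Set V} {A : AffineSubspace ℝ V} (hA : A ∈ facetSpans n E) : A < ⊤ := by
  obtain ⟨σ, hσ, v, hv, rfl⟩ := hA
  refine lt_top_iff_ne_top.mpr fun h => ?_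
  have hv' : v ∈ affineSpan ℝ ((σ.erase v : Finset V) : Set V) := by rw [h]; trivial
  have := hσ.2.2.notMem_affineSpan_sdiff ⟨v, hv⟩ Set.univ
  apply this
  convert hv' using 3
  ext y
  simp only [mem_image, Set.mem_sdiff, mem_univ, true_and, mem_singleton_iff, Subtype.exists,
    Finset.coe_erase, Subtype.mk.injEq, Finset.mem_coe]
  constructor
  · rintro ⟨a, ha, hne, rfl⟩
    exact ⟨ha, hne⟩
  · rintro ⟨ha, hne⟩
    exact ⟨y, ha, hne, rfl⟩

/-- A boundary point of a simplex has a vanishing barycentric coordinate, hence lies in the span of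
the opposite facet. This makes "off the walls" a condition that holds outside finitely many proper
subspaces. -/
theorem notMem_walls_of_notMem_facetSpans {n : ℕ} [FiniteDimensional ℝ V] (hV : finrank ℝ V = n)
    {E : Set V} {x : V} (hx : ∀ A ∈ facetSpans n E, x ∉ A) : x ∉ walls n E := by
  rw [walls, mem_iUnion₂]
  rintro ⟨σ, hσ, hxσ⟩
  rw [(isClosed_convexHull_finset σ).frontier_eq] at hxσ
  obtain ⟨hxσ, hint⟩ := hxσ
  obtain ⟨w, h1, h2, h3⟩ := exists_weights hV hσ.2.1 hσ.2.2 x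
  obtain ⟨w', p0, p1, p2⟩ := Finset.mem_convexHull'.mp hxσ
  have hw := affineIndependent_weights_unique hσ.2.2 (p1.trans h1.symm) (p2.trans h2.symm)
  rw [h3] at hint
  push Not at hint
  obtain ⟨v, hv, hv0⟩ := hint
  have hz : w v = 0 := le_antisymm hv0 (hw v hv ▸ p0 v hv)
  refine hx _ ⟨σ, hσ, v, hv, rfl⟩ ?_
  apply convexHull_subset_affineSpan
  rw [Finset.mem_convexHull']
  refine ⟨w', fun y hy => p0 y (Finset.mem_of_mem_erase hy), ?_, ?_⟩
  · rw [← p1, ← Finset.sum_erase_add σ _ hv, hw v hv, hz, add_zero]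
  · rw [← p2, ← Finset.sum_erase_add σ _ hv, hw v hv, hz, zero_smul, add_zero]

/-! ### The linear relation among the simplices with vertices in `n + 2` points -/

/-- `l` spans the affine dependencies of the points of `S`. -/
structure IsCircuit (S : Finset V) (l : V → ℝ) : Prop where
  sum_eq_zero : ∑ v ∈ S, l v = 0
  sum_smul_eq_zero : ∑ v ∈ S, l v • v = 0
  ne_zero : ∃ v ∈ S, l v ≠ 0
  unique : ∀ m : V → ℝ, ∑ v ∈ S, m v = 0 → ∑ v ∈ S, m v • v = 0 →
    ∃ c : ℝ, ∀ v ∈ S, m v = c * l v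

theorem IsCircuit.neg {S : Finset V} {l : V → ℝ} (h : IsCircuit S l) :
    IsCircuit S (fun v => -l v) where
  sum_eq_zero := by simp [h.sum_eq_zero]
  sum_smul_eq_zero := by simp [h.sum_smul_eq_zero]
  ne_zero := by simpa using h.ne_zero
  unique m h1 h2 := by
    obtain ⟨c, hc⟩ := h.unique m h1 h2
    exact ⟨-c, fun v hv => by rw [hc v hv]; ring⟩

/-- A dependency exists by counting dimensions. Since `T` is independent, a dependency is determined
by its value at the single point of `S` outside `T`, which gives uniqueness up to a factor. -/
theorem exists_isCircuit {n : ℕ} [FiniteDimensional ℝ V] (hV : finrank ℝ V = n) {S T : Finset V}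
    (hS : S.card = n + 2) (hTS : T ⊆ S) (hT : T.card = n + 1)
    (hind : AffineIndependent ℝ ((↑) : T → V)) : ∃ l, IsCircuit S l := by
  obtain ⟨l, h2, h1, hne⟩ :=
    Module.exists_nontrivial_relation_sum_zero_of_finrank_succ_lt_card (R := ℝ) (t := S)
      (by rw [hV]; omega)
  refine ⟨l, h1, h2, hne, fun m m1 m2 => ?_⟩
  obtain ⟨t, ht⟩ : ∃ t, S \ T = {t} := by
    rw [← Finset.card_eq_one, Finset.card_sdiff_of_subset hTS]
    omega
  have htS : t ∈ S := (Finset.mem_sdiff.mp (ht ▸ Finset.mem_singleton_self t)).1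
  have hST : ∀ v ∈ S, v ≠ t → v ∈ T := by
    intro v hv hvt
    by_contra h
    have : v ∈ S \ T := Finset.mem_sdiff.mpr ⟨hv, h⟩
    rw [ht, Finset.mem_singleton] at this
    exact hvt this
  have htT : t ∉ T := (Finset.mem_sdiff.mp (ht ▸ Finset.mem_singleton_self t)).2
  have vanish : ∀ p : V → ℝ, ∑ v ∈ S, p v = 0 → ∑ v ∈ S, p v • v = 0 → p t = 0 →
      ∀ v ∈ S, p v = 0 := by
    intro p p1 p2 p0 v hv
    by_cases hvt : v = t
    · rw [hvt, p0]
    refine (affineIndependent_finset_iff T).mp hind p ?_ ?_ v (hST v hv hvt)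
    · rw [← p1]
      refine Finset.sum_subset hTS fun y hy hyT => ?_
      by_contra h
      exact hyT (hST y hy fun e => h (e ▸ p0))
    · rw [← p2]
      refine Finset.sum_subset hTS fun y hy hyT => ?_
      by_contra h
      exact hyT (hST y hy fun e => h (by rw [e, p0, zero_smul]))
  have hlt : l t ≠ 0 := fun h => by
    obtain ⟨v, hv, hv0⟩ := hne
    exact hv0 (vanish l h1 h2 h v hv)
  refine ⟨m t / l t, fun v hv => ?_⟩
  refine sub_eq_zero.mp (vanish (fun v => m v - m t / l t * l v) ?_ ?_ ?_ v hv)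
  · rw [Finset.sum_sub_distrib, m1, ← Finset.mul_sum, h1, mul_zero, sub_zero]
  · simp_rw [sub_smul, mul_smul]
    rw [Finset.sum_sub_distrib, m2, ← Finset.smul_sum, h2, smul_zero, sub_zero]
  · field_simp
    ring

theorem IsCircuit.affineIndependent_erase_iff {S : Finset V} {l : V → ℝ} (h : IsCircuit S l)
    {u : V} (hu : u ∈ S) :
    AffineIndependent ℝ ((↑) : ↥(S.erase u) → V) ↔ l u ≠ 0 := by
  rw [affineIndependent_finset_iff]
  constructor
  · intro hi h0
    obtain ⟨v, hv, hv0⟩ := h.ne_zero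
    refine hv0 (hi l ?_ ?_ v (Finset.mem_erase.mpr ⟨fun e => hv0 (e ▸ h0), hv⟩))
    · rw [← h.sum_eq_zero, ← Finset.sum_erase_add S _ hu, h0, add_zero]
    · rw [← h.sum_smul_eq_zero, ← Finset.sum_erase_add S _ hu, h0, zero_smul, add_zero]
  · intro hl w w1 w2 v hv
    have h1 : ∑ y ∈ S, (if y = u then 0 else w y) = 0 := by
      rw [← Finset.sum_erase_add S _ hu, if_pos rfl, add_zero, ← w1]
      exact Finset.sum_congr rfl fun y hy => if_neg (Finset.ne_of_mem_erase hy)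
    have h2 : ∑ y ∈ S, (if y = u then 0 else w y) • y = 0 := by
      rw [← Finset.sum_erase_add S _ hu, if_pos rfl, zero_smul, add_zero, ← w2]
      exact Finset.sum_congr rfl fun y hy => by rw [if_neg (Finset.ne_of_mem_erase hy)]
    obtain ⟨c, hc⟩ := h.unique _ h1 h2
    have h0 := hc u hu
    simp only [if_true, zero_eq_mul, hl, or_false] at h0
    have := hc v (Finset.mem_of_mem_erase hv)
    rwa [if_neg (Finset.ne_of_mem_erase hv), h0, zero_mul] at this

theorem IsCircuit.mem_simplicesOn_iff {n : ℕ} {E : Set V} {S : Finset V} {l : V → ℝ}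
    (h : IsCircuit S l) (hSE : (S : Set V) ⊆ E) (hS : S.card = n + 2) {σ : Finset V} :
    σ ∈ simplicesOn n E S ↔ ∃ u ∈ S, l u ≠ 0 ∧ σ = S.erase u := by
  constructor
  · rintro ⟨⟨-, hc, hi⟩, hσS⟩
    obtain ⟨u, hu⟩ : ∃ u, S \ σ = {u} := by
      rw [← Finset.card_eq_one, Finset.card_sdiff_of_subset hσS]
      omega
    have huS : u ∈ S := (Finset.mem_sdiff.mp (hu ▸ Finset.mem_singleton_self u)).1
    have e : σ = S.erase u := by
      rw [← Finset.sdiff_singleton_eq_erase, ← hu, Finset.sdiff_sdiff_eq_self hσS]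
    subst e
    exact ⟨u, huS, (h.affineIndependent_erase_iff huS).mp hi, rfl⟩
  · rintro ⟨u, hu, hl, rfl⟩
    refine ⟨⟨fun y hy => hSE (Finset.mem_of_mem_erase hy), ?_,
      (h.affineIndependent_erase_iff hu).mpr hl⟩, Finset.erase_subset _ _⟩
    rw [Finset.card_erase_of_mem hu, hS]
    rfl

section Relation

variable {n : ℕ} [FiniteDimensional ℝ V] {E : Set V} {S : Finset V}
  {l : V → ℝ} {x : V}

theorem IsCircuit.exists_weights (hV : finrank ℝ V = n) (h : IsCircuit S l)
    (hSE : (S : Set V) ⊆ E) (hS : S.card = n + 2) (hx : x ∉ walls n E) {u : V} (hu : u ∈ S)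
    (hl : l u ≠ 0) (hxu : x ∈ convexHull ℝ ((S.erase u : Finset V) : Set V)) :
    ∃ w : V → ℝ, w u = 0 ∧ (∀ v ∈ S, v ≠ u → 0 < w v) ∧ ∑ v ∈ S, w v = 1 ∧
      ∑ v ∈ S, w v • v = x := by
  have hσ := ((h.mem_simplicesOn_iff hSE hS).mpr ⟨u, hu, hl, rfl⟩).1
  obtain ⟨w, w0, w1, w2⟩ := weights_pos_of_notMem_walls hV hσ hx hxu
  refine ⟨fun y => if y = u then 0 else w y, if_pos rfl, ?_, ?_, ?_⟩
  · intro v hv hvu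
    simp only [if_neg hvu]
    exact w0 v (Finset.mem_erase.mpr ⟨hvu, hv⟩)
  · rw [← Finset.sum_erase_add S _ hu, if_pos rfl, add_zero, ← w1]
    exact Finset.sum_congr rfl fun y hy => if_neg (Finset.ne_of_mem_erase hy)
  · beta_reduce
    rw [← Finset.sum_erase_add S _ hu, if_pos rfl, zero_smul, add_zero, ← w2]
    exact Finset.sum_congr rfl fun y hy => by rw [if_neg (Finset.ne_of_mem_erase hy)]

/-- The two systems of weights of `x` differ by `c * l`. Comparing at `u` forces `c < 0`, comparing
at `v` forces `c > 0`; both use that off the walls the remaining weights are strictly positive. -/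
theorem IsCircuit.eq_of_mem_convexHull (hV : finrank ℝ V = n) (h : IsCircuit S l)
    (hSE : (S : Set V) ⊆ E) (hS : S.card = n + 2) (hx : x ∉ walls n E) {u v : V}
    (hu : u ∈ S) (hv : v ∈ S) (hlu : 0 < l u) (hlv : 0 < l v)
    (hxu : x ∈ convexHull ℝ ((S.erase u : Finset V) : Set V))
    (hxv : x ∈ convexHull ℝ ((S.erase v : Finset V) : Set V)) : u = v := by
  by_contra huv
  obtain ⟨w, w0, wp, w1, w2⟩ := h.exists_weights hV hSE hS hx hu hlu.ne' hxu
  obtain ⟨w', w0', wp', w1', w2'⟩ := h.exists_weights hV hSE hS hx hv hlv.ne' hxv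
  obtain ⟨c, hc⟩ := h.unique (fun y => w y - w' y)
    (by rw [Finset.sum_sub_distrib, w1, w1', sub_self])
    (by simp_rw [sub_smul]; rw [Finset.sum_sub_distrib, w2, w2', sub_self])
  have h1 := hc u hu
  have h2 := hc v hv
  have h3 := wp v hv (Ne.symm huv)
  have h4 := wp' u hu huv
  simp only [w0, w0'] at h1 h2
  have h5 : 0 < c := by
    by_contra h5
    nlinarith [mul_nonneg (neg_nonneg.mpr (not_lt.mp h5)) hlv.le]
  nlinarith [mul_pos h5 hlu]

/-- Starting from weights that vanish at `u`, move in the direction `l` until the first coordinate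
becomes zero; it is one with `l < 0`. -/
theorem IsCircuit.exists_neg (hV : finrank ℝ V = n) (h : IsCircuit S l)
    (hSE : (S : Set V) ⊆ E) (hS : S.card = n + 2) (hx : x ∉ walls n E) {u : V}
    (hu : u ∈ S) (hlu : 0 < l u)
    (hxu : x ∈ convexHull ℝ ((S.erase u : Finset V) : Set V)) :
    ∃ v ∈ S, l v < 0 ∧ x ∈ convexHull ℝ ((S.erase v : Finset V) : Set V) := by
  obtain ⟨w, w0, wp, w1, w2⟩ := h.exists_weights hV hSE hS hx hu hlu.ne' hxu
  have hne : (S.filter fun v => l v < 0).Nonempty := by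
    by_contra hne
    rw [Finset.not_nonempty_iff_eq_empty, Finset.filter_eq_empty_iff] at hne
    have := (Finset.sum_eq_zero_iff_of_nonneg fun v hv => not_lt.mp (hne hv)).mp h.sum_eq_zero u hu
    exact hlu.ne' this
  -- The ratio is the time at which the coordinate of `v` reaches zero; the smallest keeps all the
  -- others nonnegative.
  obtain ⟨v, hv, hmin⟩ := Finset.exists_min_image _ (fun v => w v / (-l v)) hne
  rw [Finset.mem_filter] at hv
  refine ⟨v, hv.1, hv.2, ?_⟩
  have hnn : ∀ y ∈ S, 0 ≤ w y := fun y hy => by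
    by_cases hyu : y = u
    · rw [hyu, w0]
    · exact (wp y hy hyu).le
  set t := w v / (-l v) with ht
  have ht0 : 0 ≤ t := div_nonneg (hnn v hv.1) (by linarith [hv.2])
  have hv0 : w v + t * l v = 0 := by
    have := hv.2.ne
    rw [ht]; field_simp; ring
  rw [Finset.mem_convexHull']
  refine ⟨fun y => w y + t * l y, ?_, ?_, ?_⟩
  · intro y hy
    have hyS := Finset.mem_of_mem_erase hy
    rcases le_or_gt 0 (l y) with hl | hl
    · have := hnn y hyS
      positivity
    · have := hmin y (Finset.mem_filter.mpr ⟨hyS, hl⟩)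
      rw [le_div_iff₀ (by linarith)] at this
      linarith
  · have e : ∑ y ∈ S, (w y + t * l y) = 1 := by
      rw [Finset.sum_add_distrib, w1, ← Finset.mul_sum, h.sum_eq_zero, mul_zero, add_zero]
    rw [← e, ← Finset.sum_erase_add S _ hv.1, hv0, add_zero]
  · have e : ∑ y ∈ S, (w y + t * l y) • y = x := by
      simp_rw [add_smul, mul_smul]
      rw [Finset.sum_add_distrib, w2, ← Finset.smul_sum, h.sum_smul_eq_zero, smul_zero, add_zero]
    rw [← e, ← Finset.sum_erase_add S _ hv.1, hv0, zero_smul, add_zero]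

theorem IsCircuit.sum_sign_eq_zero (K : Type*) [Field K] (hV : finrank ℝ V = n)
    (h : IsCircuit S l) (hSE : (S : Set V) ⊆ E) (hS : S.card = n + 2) (hx : x ∉ walls n E) :
    ∑ u ∈ S, (if 0 < l u then 1 else if l u < 0 then -1 else 0 : K) *
      (if x ∈ convexHull ℝ ((S.erase u : Finset V) : Set V) then 1 else 0) = 0 := by
  set p := S.filter fun u => 0 < l u ∧ x ∈ convexHull ℝ ((S.erase u : Finset V) : Set V) with hp
  set q := S.filter fun u => l u < 0 ∧ x ∈ convexHull ℝ ((S.erase u : Finset V) : Set V) with hq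
  have hcp : p.card ≤ 1 := Finset.card_le_one.mpr fun a ha b hb => by
    rw [hp, Finset.mem_filter] at ha hb
    exact h.eq_of_mem_convexHull hV hSE hS hx ha.1 hb.1 ha.2.1 hb.2.1 ha.2.2 hb.2.2
  have hcq : q.card ≤ 1 := Finset.card_le_one.mpr fun a ha b hb => by
    rw [hq, Finset.mem_filter] at ha hb
    exact h.neg.eq_of_mem_convexHull hV hSE hS hx ha.1 hb.1 (neg_pos.mpr ha.2.1)
      (neg_pos.mpr hb.2.1) ha.2.2 hb.2.2
  have hpq : p.Nonempty ↔ q.Nonempty := by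
    constructor
    · rintro ⟨a, ha⟩
      rw [hp, Finset.mem_filter] at ha
      obtain ⟨v, hv, h1, h2⟩ := h.exists_neg hV hSE hS hx ha.1 ha.2.1 ha.2.2
      exact ⟨v, by rw [hq, Finset.mem_filter]; exact ⟨hv, h1, h2⟩⟩
    · rintro ⟨a, ha⟩
      rw [hq, Finset.mem_filter] at ha
      obtain ⟨v, hv, h1, h2⟩ := h.neg.exists_neg hV hSE hS hx ha.1 (neg_pos.mpr ha.2.1) ha.2.2
      exact ⟨v, by rw [hp, Finset.mem_filter]; exact ⟨hv, neg_lt_zero.mp h1, h2⟩⟩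
  have hcard : p.card = q.card := by
    rw [← Finset.card_pos, ← Finset.card_pos] at hpq
    omega
  have hsum : ∀ u ∈ S, (if 0 < l u then 1 else if l u < 0 then -1 else 0 : K) *
      (if x ∈ convexHull ℝ ((S.erase u : Finset V) : Set V) then 1 else 0) =
      (if 0 < l u ∧ x ∈ convexHull ℝ ((S.erase u : Finset V) : Set V) then 1 else 0) -
      (if l u < 0 ∧ x ∈ convexHull ℝ ((S.erase u : Finset V) : Set V) then 1 else 0) := by
    intro u _
    rcases lt_trichotomy 0 (l u) with hl | hl | hl
    · simp [hl, not_lt.mpr hl.le]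
    · simp [← hl]
    · simp only [hl, not_lt.mpr hl.le, if_true, if_false, true_and, false_and]
      split_ifs <;> simp
  rw [Finset.sum_congr rfl hsum, Finset.sum_sub_distrib, Finset.sum_boole, Finset.sum_boole,
    ← hp, ← hq, hcard, sub_self]

end Relation

/-! ### Rows of the incidence matrix as indicator functions -/

/-- A component is connected and misses the frontier of `σ`, so it lies in the interior or in the
complement. Entries of the matrix can therefore be read off at any point of the region. -/
theorem closure_component_subset_iff {n : ℕ} {E : Set V} {σ : Finset V}
    (hσ : σ ∈ simplices n E) {x : V} (hx : x ∈ chamberRegion n E) :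
    closure (connectedComponentIn (chamberRegion n E) x) ⊆ convexHull ℝ (σ : Set V) ↔
      x ∈ convexHull ℝ (σ : Set V) := by
  have hmem := mem_connectedComponentIn hx
  refine ⟨fun h => h (subset_closure hmem), fun hxσ => ?_⟩
  have hcl := isClosed_convexHull_finset σ
  refine closure_minimal ?_ hcl
  have hdisj : ∀ y ∈ connectedComponentIn (chamberRegion n E) x,
      y ∉ frontier (convexHull ℝ (σ : Set V)) := fun y hy hyf =>
    (connectedComponentIn_subset _ _ hy).2 (mem_iUnion₂.mpr ⟨σ, hσ, hyf⟩)
  rw [hcl.frontier_eq] at hdisj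
  rcases isPreconnected_connectedComponentIn.subset_or_subset
    (isOpen_interior (s := convexHull ℝ (σ : Set V))) hcl.isOpen_compl
    (disjoint_compl_right.mono_left interior_subset)
    (fun y hy => by
      by_cases hyσ : y ∈ convexHull ℝ (σ : Set V)
      · left
        by_contra hi
        exact hdisj y hy ⟨hyσ, hi⟩
      · exact Or.inr hyσ) with h | h
  · exact h.trans interior_subset
  · exact absurd hxσ (h hmem)

/-- The row of the incidence matrix belonging to `σ`. -/
noncomputable def rowOf (K : Type*) [Field K] (n : ℕ) (E : Set V) (σ : Finset V) :
    chambers n E → K :=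
  fun γ => if (γ : Set V) ⊆ convexHull ℝ (σ : Set V) then 1 else 0

theorem rowOf_apply (K : Type*) [Field K] {n : ℕ} {E : Set V} {σ : Finset V}
    (hσ : σ ∈ simplices n E) {x : V} (hx : x ∈ chamberRegion n E) {γ : chambers n E}
    (hγ : (γ : Set V) = closure (connectedComponentIn (chamberRegion n E) x)) :
    rowOf K n E σ γ = if x ∈ convexHull ℝ (σ : Set V) then 1 else 0 := by
  rw [rowOf, hγ]
  simp_rw [closure_component_subset_iff hσ hx]

theorem row_eq_rowOf (K : Type*) [Field K] {n : ℕ} {E : Set V} (σ : simplices n E) :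
    (incidence K n E).row σ = rowOf K n E σ := rfl

/-- Every member of `f` enters the signed relation with coefficient `1` or `-1`, so the relation can
be solved for any one of them. -/
theorem rowOf_mem_of_systemF {K : Type*} [Field K] {n : ℕ} [FiniteDimensional ℝ V]
    (hV : finrank ℝ V = n) {E : Set V} {f : Set (Finset V)} (hf : f ∈ systemF n E) {σ : Finset V}
    (hσ : σ ∈ f) (M : Submodule K (chambers n E → K))
    (hM : ∀ τ ∈ f, τ ≠ σ → rowOf K n E τ ∈ M) : rowOf K n E σ ∈ M := by
  obtain ⟨S, hSE, hS, ⟨T, hTS, hT, hi⟩, rfl⟩ := hf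
  obtain ⟨l, h⟩ := exists_isCircuit hV hS hTS hT hi
  obtain ⟨u, hu, hlu, rfl⟩ := (h.mem_simplicesOn_iff hSE hS).mp hσ
  let a : V → K := fun u => if 0 < l u then 1 else if l u < 0 then -1 else 0
  have ha : ∀ v, l v = 0 → a v = 0 := fun v hv => by simp [a, hv]
  have hau : a u ≠ 0 := by
    rcases lt_or_gt_of_ne hlu with hl | hl
    · simp [a, hl, not_lt.mpr hl.le]
    · simp [a, hl]
  have hrel : ∑ v ∈ S, a v • rowOf K n E (S.erase v) = 0 := by
    funext γ
    obtain ⟨x, hx, hγ⟩ := γ.2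
    rw [Finset.sum_apply, Pi.zero_apply, ← h.sum_sign_eq_zero K hV hSE hS hx.2]
    refine Finset.sum_congr rfl fun v hv => ?_
    rw [Pi.smul_apply, smul_eq_mul]
    by_cases hlv : l v = 0
    · rw [ha v hlv, hlv]
      simp
    · rw [rowOf_apply K ((h.mem_simplicesOn_iff hSE hS).mpr ⟨v, hv, hlv, rfl⟩).1 hx hγ]
  rw [← Finset.sum_erase_add S _ hu] at hrel
  have hmem : a u • rowOf K n E (S.erase u) ∈ M := by
    rw [← neg_eq_of_add_eq_zero_right hrel]
    refine M.neg_mem (M.sum_mem fun v hv => ?_)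
    have hvS := Finset.mem_of_mem_erase hv
    by_cases hlv : l v = 0
    · rw [ha v hlv, zero_smul]
      exact M.zero_mem
    · refine M.smul_mem _ (hM _ ((h.mem_simplicesOn_iff hSE hS).mpr ⟨v, hvS, hlv, rfl⟩) fun e => ?_)
      exact Finset.ne_of_mem_erase hv ((Finset.erase_inj S hvS).mp e)
  exact (M.smul_mem_iff hau).mp hmem

/-! ### Families of simplices that are bases inside an affine subspace -/

/-- `B` is a basis of the `d`-dimensional simplices with vertices in `E ⊆ W`: every simplex is
generated by `B`, and the indicator functions of the elements of `B` are linearly independent on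
`W` outside every finite union of proper affine subspaces. -/
structure IsRelativeBasis (K : Type*) [Field K] (d : ℕ) (W : AffineSubspace ℝ V) (E : Set V)
    (B : Set (Finset V)) : Prop where
  subset : B ⊆ simplices d E
  generated : ∀ σ ∈ simplices d E, Generated (systemF d E) B σ
  indep : ∀ (T : Finset (Finset V)) (c : Finset V → K) (𝒜 : Set (AffineSubspace ℝ V)),
    (T : Set (Finset V)) ⊆ B → 𝒜.Finite → (∀ A ∈ 𝒜, A < W) →
    (∀ x ∈ W, (∀ A ∈ 𝒜, x ∉ A) →
      ∑ σ ∈ T, c σ * (if x ∈ convexHull ℝ (σ : Set V) then 1 else 0) = 0) →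
    ∀ σ ∈ T, c σ = 0

theorem IsRelativeBasis.isGeometricalBasis {K : Type*} [Field K] {n : ℕ} [FiniteDimensional ℝ V]
    (hV : finrank ℝ V = n) {E : Set V} (hE : E.Finite) {B : Set (Finset V)}
    (h : IsRelativeBasis K n ⊤ E B) : IsGeometricalBasis K n E (systemF n E) B where
  expressed σ hσ hσB := (h.generated σ hσ).expressedInSteps hE hσB
  basis :=
    { subset := h.subset
      linearIndep := by
        rw [linearIndepOn_iff']
        intro t g ht hg σ hσ
        let c : Finset V → K := fun τ => if hτ : τ ∈ simplices n E then g ⟨τ, hτ⟩ else 0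
        have hc : ∀ τ : simplices n E, c τ = g τ := fun τ => by simp [c]
        rw [← hc]
        refine h.indep (t.image Subtype.val) c (facetSpans n E) ?_
          (facetSpans_finite n hE) (fun A hA => facetSpans_lt_top hA) ?_ σ ?_
        · intro τ hτ
          rw [Finset.coe_image] at hτ
          obtain ⟨τ', hτ', rfl⟩ := hτ
          exact ht hτ'
        · intro x _ hx
          rw [Finset.sum_image Subtype.val_injective.injOn]
          simp only [hc]
          -- A generic point either lies in a chamber, where the relation between rows applies, or
          -- outside `conv(E)`, where every indicator vanishes.
          by_cases hxP : x ∈ convexHull ℝ E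
          · have hx' : x ∈ chamberRegion n E := ⟨hxP, notMem_walls_of_notMem_facetSpans hV hx⟩
            have := congrFun hg ⟨_, x, hx', rfl⟩
            rw [Finset.sum_apply, Pi.zero_apply] at this
            refine Eq.trans (Finset.sum_congr rfl fun τ _ => ?_) this
            rw [Pi.smul_apply, smul_eq_mul, row_eq_rowOf, rowOf_apply K τ.2 hx' rfl]
          · refine Finset.sum_eq_zero fun τ _ => ?_
            rw [if_neg fun hxτ => hxP (convexHull_mono τ.2.1 hxτ), mul_zero]
        · exact Finset.mem_image_of_mem _ hσ
      span_eq := by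
        refine le_antisymm (Submodule.span_mono (image_subset_range _ _)) ?_
        rw [rowSpace, Submodule.span_le]
        rintro _ ⟨σ, rfl⟩
        rw [row_eq_rowOf]
        have : ∀ τ, Generated (systemF n E) B τ → rowOf K n E τ ∈
            Submodule.span K ((incidence K n E).row '' {σ : simplices n E | (σ : Finset V) ∈ B}) := by
          intro τ hτ
          induction hτ with
          | @base τ hτ => exact Submodule.subset_span ⟨⟨τ, h.subset hτ⟩, hτ, rfl⟩
          | step hf hσ _ ih => exact rowOf_mem_of_systemF hV hf hσ _ ih
        exact this σ (h.generated σ σ.2) }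

/-! ### Central projection from an apex -/

/-- The central projection from `x` to the hyperplane `φ (· - x) = 1`. -/
noncomputable def centralProj (x : V) (φ : V →ₗ[ℝ] ℝ) (y : V) : V :=
  x + (φ (y - x))⁻¹ • (y - x)

theorem apply_centralProj_sub {x : V} {φ : V →ₗ[ℝ] ℝ} {y : V} (hy : 0 < φ (y - x)) :
    φ (centralProj x φ y - x) = 1 := by
  rw [centralProj, add_sub_cancel_left, map_smul, smul_eq_mul, inv_mul_cancel₀ hy.ne']

theorem smul_centralProj_sub {x : V} {φ : V →ₗ[ℝ] ℝ} {y : V} (hy : 0 < φ (y - x)) :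
    φ (y - x) • (centralProj x φ y - x) = y - x := by
  rw [centralProj, add_sub_cancel_left, smul_inv_smul₀ hy.ne']

/-- The simplex spanned by the apex `x` and the points `ν p` for the vertices `p` of `τ`. -/
noncomputable def liftSimplex (x : V) (ν : V → V) (τ : Finset V) : Finset V :=
  insert x (τ.image ν)

theorem affineIndependent_insert_iff_sub {x : V} {T : Finset V} (hx : x ∉ T) :
    AffineIndependent ℝ ((↑) : ↥(insert x T) → V) ↔
      ∀ a : V → ℝ, ∑ y ∈ T, a y • (y - x) = 0 → ∀ y ∈ T, a y = 0 := by
  rw [affineIndependent_finset_iff]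
  constructor
  · intro h a ha y hy
    have hne : ∀ y ∈ T, y ≠ x := fun y hy e => hx (e ▸ hy)
    have e1 : ∑ y ∈ T, (if y = x then -∑ y ∈ T, a y else a y) = ∑ y ∈ T, a y :=
      Finset.sum_congr rfl fun y hy => if_neg (hne y hy)
    have e2 : ∑ y ∈ T, (if y = x then -∑ y ∈ T, a y else a y) • y = ∑ y ∈ T, a y • y :=
      Finset.sum_congr rfl fun y hy => by rw [if_neg (hne y hy)]
    have := h (fun y => if y = x then -∑ y ∈ T, a y else a y) ?_ ?_ y
      (Finset.mem_insert_of_mem hy)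
    · rwa [if_neg (hne y hy)] at this
    · rw [Finset.sum_insert hx, e1, if_pos rfl, neg_add_cancel]
    · simp_rw [smul_sub] at ha
      rw [Finset.sum_sub_distrib, ← Finset.sum_smul] at ha
      rw [Finset.sum_insert hx, e2, if_pos rfl, neg_smul, ← ha]
      abel
  · intro h w w1 w2
    rw [Finset.sum_insert hx] at w1 w2
    have hT : ∀ y ∈ T, w y = 0 := by
      refine h w ?_
      simp_rw [smul_sub]
      rw [Finset.sum_sub_distrib, ← Finset.sum_smul, eq_neg_of_add_eq_zero_right w1, neg_smul,
        sub_neg_eq_add, add_comm, w2]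
    intro v hv
    rcases Finset.mem_insert.mp hv with rfl | hv
    · rwa [Finset.sum_eq_zero hT, add_zero] at w1
    · exact hT v hv

/-- Injectivity has to be stated separately because `T.image g` forgets multiplicities; two points
with the same image give the dependency with weights `1` and `-1`. -/
theorem affineIndependent_image_iff {T : Finset V} {g : V → V} :
    (InjOn g T ∧ AffineIndependent ℝ ((↑) : ↥(T.image g) → V)) ↔
      ∀ b : V → ℝ, ∑ y ∈ T, b y = 0 → ∑ y ∈ T, b y • g y = 0 → ∀ y ∈ T, b y = 0 := by
  rw [affineIndependent_finset_iff]
  constructor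
  · rintro ⟨hinj, h⟩ b b1 b2 y hy
    have hinv : ∀ y ∈ T, Function.invFunOn g T (g y) = y := hinj.leftInvOn_invFunOn
    have := h (fun p => b (Function.invFunOn g T p)) ?_ ?_ (g y) (Finset.mem_image_of_mem g hy)
    · rwa [hinv y hy] at this
    · rw [Finset.sum_image hinj, ← b1]
      exact Finset.sum_congr rfl fun y hy => by rw [hinv y hy]
    · rw [Finset.sum_image hinj, ← b2]
      exact Finset.sum_congr rfl fun y hy => by rw [hinv y hy]
  · intro h
    have hinj : InjOn g T := by
      intro y hy z hz hyz
      by_contra hne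
      have := h (fun v => (if v = y then 1 else 0) - (if v = z then 1 else 0)) ?_ ?_ y hy
      · simp [hne] at this
      · rw [Finset.sum_sub_distrib, Finset.sum_ite_eq' T y, Finset.sum_ite_eq' T z]
        simp only [Finset.mem_coe] at hy hz
        simp [hy, hz]
      · simp only [Finset.mem_coe] at hy hz
        simp_rw [sub_smul, ite_smul, one_smul, zero_smul]
        rw [Finset.sum_sub_distrib, Finset.sum_ite_eq' T y, Finset.sum_ite_eq' T z]
        simp [hy, hz, hyz]
    refine ⟨hinj, fun w w1 w2 v hv => ?_⟩
    obtain ⟨y, hy, rfl⟩ := Finset.mem_image.mp hv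
    rw [Finset.sum_image hinj] at w1 w2
    exact h (fun y => w (g y)) w1 w2 y hy

/-- Multiplying the weight of `y` by `φ (y - x)` turns linear dependencies of the vectors `y - x`
into affine dependencies of the projections; applying `φ` shows that the new weights sum to zero. -/
theorem affineIndependent_insert_iff_centralProj {x : V} {φ : V →ₗ[ℝ] ℝ} {T : Finset V}
    (hT : ∀ y ∈ T, 0 < φ (y - x)) :
    AffineIndependent ℝ ((↑) : ↥(insert x T) → V) ↔
      InjOn (centralProj x φ) T ∧
        AffineIndependent ℝ ((↑) : ↥(T.image (centralProj x φ)) → V) := by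
  have hx : x ∉ T := fun h => by simpa using hT x h
  rw [affineIndependent_insert_iff_sub hx, affineIndependent_image_iff]
  constructor
  · intro h b b1 b2 y hy
    have := h (fun y => b y * (φ (y - x))⁻¹) ?_ y hy
    · exact (mul_eq_zero.mp this).resolve_right (inv_ne_zero (hT y hy).ne')
    · have e : ∀ y ∈ T, (b y * (φ (y - x))⁻¹) • (y - x) = b y • centralProj x φ y - b y • x := by
        intro y _
        rw [← smul_sub, centralProj, add_sub_cancel_left, mul_smul]
      rw [Finset.sum_congr rfl e, Finset.sum_sub_distrib, b2, ← Finset.sum_smul, b1, zero_smul,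
        sub_zero]
  · intro h a ha y hy
    have b1 : ∑ y ∈ T, a y * φ (y - x) = 0 := by
      have := congrArg φ ha
      simpa using this
    have := h (fun y => a y * φ (y - x)) b1 ?_ y hy
    · exact (mul_eq_zero.mp this).resolve_right (hT y hy).ne'
    · have e : ∀ y ∈ T, (a y * φ (y - x)) • centralProj x φ y =
          a y • (y - x) + (a y * φ (y - x)) • x := by
        intro y hy
        have e1 := smul_centralProj_sub (hT y hy)
        rw [mul_smul, mul_smul, ← smul_add]
        rw [smul_sub, sub_eq_iff_eq_add] at e1
        rw [e1]
      rw [Finset.sum_congr rfl e, Finset.sum_add_distrib, ha, ← Finset.sum_smul, b1, zero_smul,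
        add_zero]

/-- The points of `L` lie on the positive side of `x` for `φ`, and `ν` chooses one of them on each
ray from `x`, the rays being represented by their points in the hyperplane `φ (· - x) = 1`. -/
structure IsApex (x : V) (φ : V →ₗ[ℝ] ℝ) (L : Set V) (ν : V → V) : Prop where
  pos : ∀ y ∈ L, 0 < φ (y - x)
  mem : ∀ p ∈ centralProj x φ '' L, ν p ∈ L
  proj : ∀ p ∈ centralProj x φ '' L, centralProj x φ (ν p) = p

/-! ### Lifting simplices and their relations to an apex -/

namespace IsApex

variable {x : V} {φ : V →ₗ[ℝ] ℝ} {L : Set V} {ν : V → V}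

theorem notMem (h : IsApex x φ L ν) : x ∉ L := fun hx => by simpa using h.pos x hx

theorem injOn (h : IsApex x φ L ν) : InjOn ν (centralProj x φ '' L) := fun p hp q hq e => by
  rw [← h.proj p hp, ← h.proj q hq, e]

theorem notMem_image (h : IsApex x φ L ν) {τ : Finset V}
    (hτ : (τ : Set V) ⊆ centralProj x φ '' L) : x ∉ τ.image ν := fun hx => by
  obtain ⟨p, hp, hpx⟩ := Finset.mem_image.mp hx
  exact h.notMem (hpx ▸ h.mem p (hτ hp))

theorem image_subset (h : IsApex x φ L ν) {τ : Finset V}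
    (hτ : (τ : Set V) ⊆ centralProj x φ '' L) : ((τ.image ν : Finset V) : Set V) ⊆ L := fun y hy => by
  obtain ⟨p, hp, rfl⟩ := Finset.mem_image.mp hy
  exact h.mem p (hτ hp)

theorem image_image (h : IsApex x φ L ν) {τ : Finset V}
    (hτ : (τ : Set V) ⊆ centralProj x φ '' L) : (τ.image ν).image (centralProj x φ) = τ := by
  rw [Finset.image_image]
  refine (Finset.image_congr fun p hp => ?_).trans Finset.image_id
  exact h.proj p (hτ hp)

theorem card_liftSimplex (h : IsApex x φ L ν) {τ : Finset V}
    (hτ : (τ : Set V) ⊆ centralProj x φ '' L) : (liftSimplex x ν τ).card = τ.card + 1 := by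
  rw [liftSimplex, Finset.card_insert_of_notMem (h.notMem_image hτ),
    Finset.card_image_of_injOn (h.injOn.mono hτ)]

theorem image_erase_liftSimplex (h : IsApex x φ L ν) {τ : Finset V}
    (hτ : (τ : Set V) ⊆ centralProj x φ '' L) :
    ((liftSimplex x ν τ).erase x).image (centralProj x φ) = τ := by
  rw [liftSimplex, Finset.erase_insert (h.notMem_image hτ), h.image_image hτ]

theorem liftSimplex_subset (h : IsApex x φ L ν) {τ : Finset V}
    (hτ : (τ : Set V) ⊆ centralProj x φ '' L) :
    ((liftSimplex x ν τ : Finset V) : Set V) ⊆ insert x L := by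
  rw [liftSimplex, Finset.coe_insert]
  exact insert_subset_insert (h.image_subset hτ)

theorem liftSimplex_mem_simplices (h : IsApex x φ L ν) {d : ℕ} {τ : Finset V}
    (hτ : τ ∈ simplices d (centralProj x φ '' L)) :
    liftSimplex x ν τ ∈ simplices (d + 1) (insert x L) := by
  refine ⟨h.liftSimplex_subset hτ.1, by rw [h.card_liftSimplex hτ.1, hτ.2.1], ?_⟩
  rw [liftSimplex, affineIndependent_insert_iff_centralProj (φ := φ)
    fun y hy => h.pos y (h.image_subset hτ.1 hy), h.image_image hτ.1]
  refine ⟨?_, hτ.2.2⟩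
  intro y hy z hz e
  obtain ⟨p, hp, rfl⟩ := Finset.mem_image.mp hy
  obtain ⟨q, hq, rfl⟩ := Finset.mem_image.mp hz
  rw [h.proj p (hτ.1 hp), h.proj q (hτ.1 hq)] at e
  rw [e]

theorem erase_subset {α : Type*} {x : α} {L : Set α} {σ : Finset α} (hσ : (σ : Set α) ⊆ insert x L) :
    ((σ.erase x : Finset α) : Set α) ⊆ L := fun _ hy =>
  (hσ (Finset.mem_of_mem_erase hy)).resolve_left (Finset.ne_of_mem_erase hy)

theorem injOn_centralProj (h : IsApex x φ L ν) {d : ℕ} {σ : Finset V}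
    (hσ : σ ∈ simplices d (insert x L)) (hx : x ∈ σ) :
    InjOn (centralProj x φ) (σ.erase x : Finset V) ∧
      AffineIndependent ℝ ((↑) : ↥((σ.erase x).image (centralProj x φ)) → V) := by
  rw [← affineIndependent_insert_iff_centralProj fun y hy => h.pos y (erase_subset hσ.1 hy),
    Finset.insert_erase hx]
  exact hσ.2.2

theorem image_erase_mem_simplices (h : IsApex x φ L ν) {d : ℕ} {σ : Finset V}
    (hσ : σ ∈ simplices (d + 1) (insert x L)) (hx : x ∈ σ) :
    (σ.erase x).image (centralProj x φ) ∈ simplices d (centralProj x φ '' L) := by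
  obtain ⟨h1, h2⟩ := h.injOn_centralProj hσ hx
  refine ⟨?_, ?_, h2⟩
  · rw [Finset.coe_image]
    exact image_mono (erase_subset hσ.1)
  · rw [Finset.card_image_of_injOn h1, Finset.card_erase_of_mem hx, hσ.2.1]
    rfl

variable {d : ℕ} {E : Set V} {B Bt : Set (Finset V)}

/-- Expression in the hyperplane lifts to expression of the simplices with apex `x`. -/
theorem generated_liftSimplex (h : IsApex x φ L ν) (hE : insert x L ⊆ E)
    (hL : ∀ σ ∈ simplices (d + 1) L, Generated (systemF (d + 1) E) B σ)
    (hB : ∀ τ ∈ Bt, liftSimplex x ν τ ∈ B) {τ : Finset V}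
    (hτ : Generated (systemF d (centralProj x φ '' L)) Bt τ) :
    Generated (systemF (d + 1) E) B (liftSimplex x ν τ) := by
  induction hτ with
  | base hτ => exact .base (hB _ hτ)
  | @step τ f hf hτ _ ih =>
    obtain ⟨S, hS, hSc, ⟨T, hTS, hTc, hTi⟩, rfl⟩ := hf
    have hTP : (T : Set V) ⊆ centralProj x φ '' L := fun y hy => hS (hTS hy)
    -- The relation on `S` is coned off at `x`. Members containing `x` are lifts of members of the
    -- family on `S`; a member without `x` has all its vertices in `L`.
    refine Generated.step (f := simplicesOn (d + 1) E (liftSimplex x ν S))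
      ⟨_, (h.liftSimplex_subset hS).trans hE, by rw [h.card_liftSimplex hS, hSc],
        ⟨liftSimplex x ν T, Finset.insert_subset_insert _ (Finset.image_subset_image hTS),
          (h.liftSimplex_mem_simplices ⟨hTP, hTc, hTi⟩).2⟩, rfl⟩
      ⟨simplices_mono hE (h.liftSimplex_mem_simplices hτ.1),
        Finset.insert_subset_insert _ (Finset.image_subset_image hτ.2)⟩ ?_
    rintro σ ⟨hσ, hσS⟩ hne
    have hσL : (σ : Set V) ⊆ insert x L := fun y hy => h.liftSimplex_subset hS (hσS hy)
    by_cases hx : x ∈ σ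
    · have hmem := h.image_erase_mem_simplices ⟨hσL, hσ.2⟩ hx
      have hsub : ∀ y ∈ σ.erase x, ∃ p ∈ S, ν p = y := fun y hy => by
        have := hσS (Finset.mem_of_mem_erase hy)
        rw [liftSimplex, Finset.mem_insert] at this
        exact Finset.mem_image.mp (this.resolve_left (Finset.ne_of_mem_erase hy))
      have hlift : liftSimplex x ν ((σ.erase x).image (centralProj x φ)) = σ := by
        rw [liftSimplex, Finset.image_image, ← Finset.insert_erase hx, Finset.erase_insert
          (Finset.notMem_erase x σ)]
        congr 1
        refine (Finset.image_congr fun y hy => ?_).trans Finset.image_id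
        obtain ⟨p, hp, rfl⟩ := hsub y hy
        simp only [Function.comp_apply, h.proj p (hS hp), id]
      rw [← hlift]
      refine ih _ ⟨hmem, ?_⟩ fun e => hne (by rw [← hlift, e])
      intro q hq
      obtain ⟨y, hy, rfl⟩ := Finset.mem_image.mp hq
      obtain ⟨p, hp, rfl⟩ := hsub y hy
      rwa [h.proj p (hS hp)]
    · exact hL σ ⟨fun y hy => (hσL hy).resolve_left fun e => hx (e ▸ hy), hσ.2⟩

/-- If the simplices without the apex are generated and the simplices in the hyperplane are
generated by `Bt`, then all simplices are generated. -/
theorem generated (h : IsApex x φ L ν) (hE : insert x L ⊆ E)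
    (hL : ∀ σ ∈ simplices (d + 1) L, Generated (systemF (d + 1) E) B σ)
    (hB : ∀ τ ∈ Bt, liftSimplex x ν τ ∈ B)
    (hBt : ∀ τ ∈ simplices d (centralProj x φ '' L),
      Generated (systemF d (centralProj x φ '' L)) Bt τ) :
    ∀ σ ∈ simplices (d + 1) (insert x L), Generated (systemF (d + 1) E) B σ := by
  -- Induction on the number of vertices that are not the point chosen by `ν` on their ray; with
  -- none, `σ` is itself a lift.
  have main : ∀ m : ℕ, ∀ σ ∈ simplices (d + 1) (insert x L), x ∈ σ →
      ((σ.erase x).filter fun y => ν (centralProj x φ y) ≠ y).card = m →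
      Generated (systemF (d + 1) E) B σ := by
    intro m
    induction m with
    | zero =>
      intro σ hσ hx hm
      rw [Finset.card_eq_zero, Finset.filter_eq_empty_iff] at hm
      have hlift : liftSimplex x ν ((σ.erase x).image (centralProj x φ)) = σ := by
        rw [liftSimplex, Finset.image_image]
        have : (σ.erase x).image (ν ∘ centralProj x φ) = σ.erase x :=
          (Finset.image_congr fun y hy => not_not.mp (hm hy)).trans Finset.image_id
        rw [this, Finset.insert_erase hx]
      rw [← hlift]
      exact h.generated_liftSimplex hE hL hB (hBt _ (h.image_erase_mem_simplices hσ hx))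
    | succ m ih =>
      intro σ hσ hx hm
      obtain ⟨y, hy⟩ := Finset.card_pos.mp (hm.symm ▸ Nat.succ_pos m :
        0 < ((σ.erase x).filter fun y => ν (centralProj x φ y) ≠ y).card)
      have hmem := hy
      rw [Finset.mem_filter] at hy
      obtain ⟨hy, hyν⟩ := hy
      set z := ν (centralProj x φ y) with hz
      have hinj := (h.injOn_centralProj hσ hx).1
      have hyL : y ∈ L := erase_subset hσ.1 hy
      have hzL : z ∈ L := h.mem _ (mem_image_of_mem _ hyL)
      have hpz : centralProj x φ z = centralProj x φ y := h.proj _ (mem_image_of_mem _ hyL)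
      have hzx : z ≠ x := fun e => h.notMem (e ▸ hzL)
      have hyx : y ≠ x := Finset.ne_of_mem_erase hy
      have hyσ : y ∈ σ := Finset.mem_of_mem_erase hy
      have hzσ : z ∉ σ := fun hzσ =>
        hyν (hinj (Finset.mem_erase.mpr ⟨hzx, hzσ⟩) hy hpz)
      have hSL : ((insert z σ : Finset V) : Set V) ⊆ insert x L := by
        rw [Finset.coe_insert]
        exact insert_subset (Or.inr hzL) hσ.1
      have hScard : (insert z σ).card = d + 1 + 2 := by
        rw [Finset.card_insert_of_notMem hzσ, hσ.2.1]
      -- The points `y` and `z` lie on one ray from `x`, so no nondegenerate simplex contains `x`,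
      -- `y` and `z`. Among the members containing `x`, only `σ` and the simplex with `y` replaced
      -- by `z` are left, and the latter has one bad vertex fewer.
      refine Generated.step (f := simplicesOn (d + 1) E (insert z σ))
        ⟨_, hSL.trans hE, hScard, ⟨σ, Finset.subset_insert _ _, hσ.2⟩, rfl⟩
        ⟨simplices_mono hE hσ, Finset.subset_insert _ _⟩ ?_
      rintro τ ⟨hτ, hτS⟩ hne
      have hτL : (τ : Set V) ⊆ insert x L := fun y hy => hSL (hτS hy)
      by_cases hxτ : x ∈ τ
      · have hτ' : τ ∈ simplices (d + 1) (insert x L) := ⟨hτL, hτ.2⟩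
        have hinjτ := (h.injOn_centralProj hτ' hxτ).1
        obtain ⟨u, hu⟩ : ∃ u, insert z σ \ τ = {u} := by
          rw [← Finset.card_eq_one, Finset.card_sdiff_of_subset hτS, hScard, hτ.2.1]
          omega
        have huτ : τ = (insert z σ).erase u := by
          rw [← Finset.sdiff_singleton_eq_erase, ← hu, Finset.sdiff_sdiff_eq_self hτS]
        have hzu : z ≠ u := fun e => hne (by rw [huτ, ← e, Finset.erase_insert hzσ])
        have hyu : y = u := by
          by_contra hyu
          have h1 : z ∈ τ := by rw [huτ]; simp [hzu]
          have h2 : y ∈ τ := by rw [huτ]; simp [hyu, hyσ]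
          exact hyν (hinjτ (Finset.mem_erase.mpr ⟨hzx, h1⟩) (Finset.mem_erase.mpr ⟨hyx, h2⟩) hpz)
        refine ih τ hτ' hxτ ?_
        have hfil : (τ.erase x).filter (fun y => ν (centralProj x φ y) ≠ y) =
            ((σ.erase x).filter fun y => ν (centralProj x φ y) ≠ y).erase y := by
          ext v
          rw [huτ, ← hyu]
          simp only [Finset.mem_filter, Finset.mem_erase, Finset.mem_insert]
          constructor
          · rintro ⟨⟨h1, h2, h3 | h3⟩, h4⟩
            · exfalso
              rw [h3, hpz] at h4
              exact h4 rfl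
            · exact ⟨h2, ⟨h1, h3⟩, h4⟩
          · rintro ⟨h2, ⟨h1, h3⟩, h4⟩
            exact ⟨⟨h1, h2, Or.inr h3⟩, h4⟩
        rw [hfil, Finset.card_erase_of_mem hmem, hm]
        rfl
      · exact hL τ ⟨fun y hy => (hτL hy).resolve_left fun e => hxτ (e ▸ hy), hτ.2⟩
  intro σ hσ
  by_cases hx : x ∈ σ
  · exact main _ σ hσ hx rfl
  · exact hL σ ⟨fun y hy => (hσ.1 hy).resolve_left fun e => hx (e ▸ hy), hσ.2⟩

end IsApex

/-! ### Indicator functions near the apex -/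

namespace IsApex

variable {x : V} {φ : V →ₗ[ℝ] ℝ} {L : Set V} {ν : V → V} {τ : Finset V} {y : V}

theorem apply_sub_eq_one (h : IsApex x φ L ν) {p : V} (hp : p ∈ centralProj x φ '' L) :
    φ (p - x) = 1 := by
  obtain ⟨y, hy, rfl⟩ := hp
  exact apply_centralProj_sub (h.pos y hy)

theorem smul_sub_eq (h : IsApex x φ L ν) {p : V} (hp : p ∈ centralProj x φ '' L) :
    φ (ν p - x) • (p - x) = ν p - x := by
  have := smul_centralProj_sub (h.pos _ (h.mem p hp))
  rwa [h.proj p hp] at this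

/-- After subtracting `x` the weight of the apex drops out. Rescaling the others by `φ (ν p - x)`
gives weights on `τ` with sum `ε`, as `φ` shows. -/
theorem mem_convexHull_of_liftSimplex (h : IsApex x φ L ν)
    (hτ : (τ : Set V) ⊆ centralProj x φ '' L) (hy : φ (y - x) = 1) {ε : ℝ} (hε : 0 < ε)
    (hmem : x + ε • (y - x) ∈ convexHull ℝ ((liftSimplex x ν τ : Finset V) : Set V)) :
    y ∈ convexHull ℝ (τ : Set V) := by
  obtain ⟨u, u0, u1, u2⟩ := Finset.mem_convexHull'.mp hmem
  rw [liftSimplex, Finset.sum_insert (h.notMem_image hτ),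
    Finset.sum_image (h.injOn.mono hτ)] at u1 u2
  have key : ∑ p ∈ τ, (u (ν p) * φ (ν p - x)) • (p - x) = ε • (y - x) := by
    have e : ∀ p ∈ τ, (u (ν p) * φ (ν p - x)) • (p - x) = u (ν p) • ν p - u (ν p) • x := by
      intro p hp
      rw [mul_smul, h.smul_sub_eq (hτ hp), smul_sub]
    rw [Finset.sum_congr rfl e, Finset.sum_sub_distrib, ← Finset.sum_smul,
      eq_sub_of_add_eq' u1, eq_sub_of_add_eq' u2, sub_smul, one_smul]
    abel
  have hsum : ∑ p ∈ τ, u (ν p) * φ (ν p - x) = ε := by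
    have := congrArg φ key
    rw [map_sum, map_smul, hy, smul_eq_mul, mul_one] at this
    rw [← this]
    refine Finset.sum_congr rfl fun p hp => ?_
    rw [map_smul, h.apply_sub_eq_one (hτ hp), smul_eq_mul, mul_one]
  rw [Finset.mem_convexHull']
  refine ⟨fun p => ε⁻¹ * (u (ν p) * φ (ν p - x)), fun p hp => ?_, ?_, ?_⟩
  · have h1 := u0 (ν p) (Finset.mem_insert_of_mem (Finset.mem_image_of_mem ν hp))
    have h2 := h.pos _ (h.mem p (hτ hp))
    positivity
  · rw [← Finset.mul_sum, hsum, inv_mul_cancel₀ hε.ne']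
  · simp_rw [mul_smul ε⁻¹]
    rw [← Finset.smul_sum]
    simp_rw [smul_sub] at key
    rw [Finset.sum_sub_distrib, ← Finset.sum_smul, hsum] at key
    rw [sub_left_injective key, inv_smul_smul₀ hε.ne']

/-- The homothety with centre `x` and ratio `ε` moves each `p` into the segment from `x` to `ν p`;
the bound on `ε` is exactly what prevents overshooting. -/
theorem liftSimplex_mem_convexHull (h : IsApex x φ L ν)
    (hτ : (τ : Set V) ⊆ centralProj x φ '' L) (hy : y ∈ convexHull ℝ (τ : Set V)) {ε : ℝ}
    (hε : 0 < ε) (hετ : ∀ p ∈ τ, ε ≤ φ (ν p - x)) :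
    x + ε • (y - x) ∈ convexHull ℝ ((liftSimplex x ν τ : Finset V) : Set V) := by
  set C := convexHull ℝ ((liftSimplex x ν τ : Finset V) : Set V) with hC
  have hcC : Convex ℝ C := convex_convexHull ℝ _
  have hsub : (liftSimplex x ν τ : Set V) ⊆ C := subset_convexHull ℝ _
  have hxC : x ∈ C := hsub (Finset.mem_insert_self _ _)
  have hpre : convexHull ℝ (τ : Set V) ⊆ AffineMap.homothety x ε ⁻¹' C := by
    refine convexHull_min (fun p hp => ?_) (hcC.affine_preimage _)
    have hνC : ν p ∈ C := hsub (Finset.mem_insert_of_mem (Finset.mem_image_of_mem ν hp))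
    have hs := h.pos _ (h.mem p (hτ hp))
    have := hcC.add_smul_sub_mem hxC hνC (t := ε / φ (ν p - x))
      ⟨by positivity, (div_le_one hs).mpr (hετ p hp)⟩
    have e : (ε / φ (ν p - x)) • (ν p - x) = ε • (p - x) := by
      nth_rw 2 [← h.smul_sub_eq (hτ hp)]
      rw [smul_smul, div_mul_cancel₀ _ hs.ne']
    rw [e] at this
    rw [mem_preimage, AffineMap.homothety_apply, vsub_eq_sub, vadd_eq_add, add_comm]
    exact this
  have := hpre hy
  rwa [mem_preimage, AffineMap.homothety_apply, vsub_eq_sub, vadd_eq_add, add_comm] at this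

theorem eventually_mem_iff (h : IsApex x φ L ν)
    (hτ : (τ : Set V) ⊆ centralProj x φ '' L) (hy : φ (y - x) = 1) :
    ∀ᶠ ε : ℝ in nhdsWithin 0 (Ioi 0),
      (x + ε • (y - x) ∈ convexHull ℝ ((liftSimplex x ν τ : Finset V) : Set V) ↔
        y ∈ convexHull ℝ (τ : Set V)) := by
  have h1 : ∀ᶠ ε : ℝ in nhdsWithin 0 (Ioi 0), ∀ p ∈ τ, ε ≤ φ (ν p - x) := by
    rw [Filter.eventually_all_finset]
    exact fun p hp => eventually_nhdsWithin_of_eventually_nhds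
      (eventually_le_nhds (h.pos _ (h.mem p (hτ hp))))
  filter_upwards [h1, self_mem_nhdsWithin] with ε hε hε0
  exact ⟨h.mem_convexHull_of_liftSimplex hτ hy hε0,
    fun hy => h.liftSimplex_mem_convexHull hτ hy hε0 hε⟩

/-- The apex and the section together span `W`. Hence a proper subspace of `W` through `x` cuts the
section in a proper subspace. -/
theorem le_of_section_le {W H A : AffineSubspace ℝ V} (hH : ∀ z, z ∈ H ↔ z ∈ W ∧ φ (z - x) = 1)
    (hx : x ∈ W) (hne : (H : Set V).Nonempty) (hxA : x ∈ A) (hHA : H ≤ A) : W ≤ A := by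
  obtain ⟨p, hp⟩ := hne
  have hpA : p ∈ A := hHA hp
  obtain ⟨hpW, hp1⟩ := (hH p).mp hp
  intro z hz
  by_cases h0 : φ (z - x) = 0
  · have hq : p + (z - x) ∈ A := hHA ((hH _).mpr ⟨?_, ?_⟩)
    · have := A.smul_vsub_vadd_mem 1 hq hpA hxA
      simpa using this
    · have := W.smul_vsub_vadd_mem 1 hz hx hpW
      simpa [add_comm] using this
    · rw [add_sub_right_comm, map_add, hp1, h0, add_zero]
  · have hq : (φ (z - x))⁻¹ • (z - x) + x ∈ A := hHA ((hH _).mpr ⟨?_, ?_⟩)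
    · have := A.smul_vsub_vadd_mem (φ (z - x)) hq hxA hxA
      rwa [vsub_eq_sub, vadd_eq_add, add_sub_cancel_right, smul_inv_smul₀ h0, sub_add_cancel] at this
    · exact W.smul_vsub_vadd_mem _ hz hx hx
    · rw [add_sub_cancel_right, map_smul, smul_eq_mul, inv_mul_cancel₀ h0]

theorem eventually_notMem [FiniteDimensional ℝ V] {A : AffineSubspace ℝ V}
    (hA : x ∈ A → y ∉ A) : ∀ᶠ ε : ℝ in nhdsWithin 0 (Ioi 0), x + ε • (y - x) ∉ A := by
  by_cases hx : x ∈ A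
  · filter_upwards [self_mem_nhdsWithin] with ε hε hmem
    apply hA hx
    have := A.smul_vsub_vadd_mem ε⁻¹ hmem hx hx
    have hε' : ε ≠ 0 := (mem_Ioi.mp hε).ne'
    simpa [hε'] using this
  · apply eventually_nhdsWithin_of_eventually_nhds
    have hcont : Continuous fun ε : ℝ => x + ε • (y - x) := by fun_prop
    have hopen : IsOpen ((fun ε : ℝ => x + ε • (y - x)) ⁻¹' (A : Set V)ᶜ) :=
      A.closed_of_finiteDimensional.isOpen_compl.preimage hcont
    exact hopen.mem_nhds (by simpa using hx)

/-- In a relation among indicator functions the coefficients of the simplices with apex `x`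
vanish, because near `x` only these simplices are met. -/
theorem coeff_eq_zero [FiniteDimensional ℝ V] {K : Type*} [Field K] {d : ℕ}
    {W H : AffineSubspace ℝ V} {Bt : Set (Finset V)} (h : IsApex x φ L ν) (hx : x ∈ W)
    (hH : ∀ z, z ∈ H ↔ z ∈ W ∧ φ (z - x) = 1) (hne : (H : Set V).Nonempty)
    (hBt : IsRelativeBasis K d H (centralProj x φ '' L) Bt) {T : Finset (Finset V)}
    {c : Finset V → K} {𝒜 : Set (AffineSubspace ℝ V)} (h𝒜 : 𝒜.Finite) (h𝒜W : ∀ A ∈ 𝒜, A < W)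
    (hrel : ∀ z ∈ W, (∀ A ∈ 𝒜, z ∉ A) →
      ∑ σ ∈ T, c σ * (if z ∈ convexHull ℝ (σ : Set V) then 1 else 0) = 0)
    (hT : ∀ σ ∈ T, c σ = 0 ∨ (∃ τ ∈ Bt, liftSimplex x ν τ = σ) ∨ ∀ v ∈ σ, 1 < φ (v - x)) :
    ∀ τ ∈ Bt, liftSimplex x ν τ ∈ T → c (liftSimplex x ν τ) = 0 := by
  set T₁ := T.filter fun σ => ∃ τ ∈ Bt, liftSimplex x ν τ = σ with hT₁
  let ρ : Finset V → Finset V := fun σ => (σ.erase x).image (centralProj x φ)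
  have hρ : ∀ τ ∈ Bt, ρ (liftSimplex x ν τ) = τ := fun τ hτ =>
    h.image_erase_liftSimplex (hBt.subset hτ).1
  have hρ' : ∀ σ ∈ T₁, ρ σ ∈ Bt ∧ liftSimplex x ν (ρ σ) = σ := by
    intro σ hσ
    obtain ⟨τ, hτ, rfl⟩ := (Finset.mem_filter.mp hσ).2
    rw [hρ τ hτ]
    exact ⟨hτ, rfl⟩
  have hinj : InjOn ρ T₁ := fun σ hσ σ' hσ' e => by
    rw [← (hρ' σ hσ).2, ← (hρ' σ' hσ').2, e]
  intro τ hτ hτT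
  -- Only the exceptional subspaces through `x` have to be avoided in the section; the others are
  -- closed and stay away from `x + ε • (y - x)` for small `ε`.
  refine hBt.indep (T₁.image ρ) (fun τ => c (liftSimplex x ν τ))
    ((fun A => A ⊓ H) '' {A ∈ 𝒜 | x ∈ A}) ?_ ((h𝒜.sep _).image _) ?_ ?_ τ ?_
  · rw [Finset.coe_image]
    rintro _ ⟨σ, hσ, rfl⟩
    exact (hρ' σ hσ).1
  · rintro _ ⟨A, ⟨hA, hxA⟩, rfl⟩
    refine lt_of_le_of_ne inf_le_right fun e => ?_
    exact (h𝒜W A hA).not_ge (le_of_section_le hH hx hne hxA (inf_eq_right.mp e))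
  · intro y hy hy𝒜
    obtain ⟨hyW, hy1⟩ := (hH y).mp hy
    have e1 : ∀ᶠ ε : ℝ in nhdsWithin 0 (Ioi 0), ∀ A ∈ 𝒜, x + ε • (y - x) ∉ A := by
      rw [Filter.eventually_all_finite h𝒜]
      exact fun A hA => eventually_notMem fun hxA hyA => hy𝒜 _ ⟨A, ⟨hA, hxA⟩, rfl⟩ ⟨hyA, hy⟩
    have e2 : ∀ᶠ ε : ℝ in nhdsWithin 0 (Ioi 0), ∀ σ ∈ T₁,
        (x + ε • (y - x) ∈ convexHull ℝ (σ : Set V) ↔ y ∈ convexHull ℝ (ρ σ : Set V)) := by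
      rw [Filter.eventually_all_finset]
      intro σ hσ
      have := h.eventually_mem_iff (hBt.subset (hρ' σ hσ).1).1 hy1
      rwa [(hρ' σ hσ).2] at this
    have e3 : ∀ᶠ ε : ℝ in nhdsWithin 0 (Ioi 0), ε < 1 :=
      eventually_nhdsWithin_of_eventually_nhds (eventually_lt_nhds one_pos)
    obtain ⟨ε, hε1, hε2, hε3⟩ := (e1.and (e2.and e3)).exists
    have hzW : x + ε • (y - x) ∈ W := by
      have := W.smul_vsub_vadd_mem ε hyW hx hx
      simpa [add_comm] using this
    refine Eq.trans ?_ (hrel _ hzW hε1)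
    rw [Finset.sum_image hinj, hT₁, Finset.sum_filter]
    refine Finset.sum_congr rfl fun σ hσ => ?_
    by_cases h1 : ∃ τ ∈ Bt, liftSimplex x ν τ = σ
    · have hσ₁ : σ ∈ T₁ := Finset.mem_filter.mpr ⟨hσ, h1⟩
      rw [if_pos h1, (hρ' σ hσ₁).2]
      simp_rw [hε2 σ hσ₁]
    · rw [if_neg h1]
      rcases hT σ hσ with h4 | h4 | h4
      · rw [h4, zero_mul]
      · exact absurd h4 h1
      · rw [if_neg, mul_zero]
        intro h3
        -- The simplex lies in this half-space, while at the test point `φ` takes the value `ε < 1`.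
        have hconv : Convex ℝ {v | 1 < φ (v - x)} := by
          have : {v | 1 < φ (v - x)} = {v | 1 + φ x < φ v} := by
            ext v
            simp only [mem_ofPred_eq, map_sub]
            constructor <;> intro <;> linarith
          rw [this]
          exact convex_halfSpace_gt φ.isLinear _
        have : x + ε • (y - x) ∈ {v | 1 < φ (v - x)} :=
          convexHull_min (fun v hv => h4 v hv) hconv h3
        rw [mem_ofPred_eq, add_sub_cancel_left, map_smul, hy1, smul_eq_mul, mul_one] at this
        linarith
  · rw [Finset.mem_image]
    exact ⟨_, Finset.mem_filter.mpr ⟨hτT, τ, hτ, rfl⟩, hρ τ hτ⟩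

end IsApex

/-- The inductive step of the algorithm: bases in the sections at the points `e k` lift to a
basis. -/
theorem isRelativeBasis_of_isApex [FiniteDimensional ℝ V] {K : Type*} [Field K] {d N : ℕ}
    {W : AffineSubspace ℝ V} {E : Set V} (hEW : E ⊆ W) {e : Fin N → V} (he : range e = E)
    {Bk : Fin N → Set (Finset V)}
    (h : ∀ k, ((Ioi k).Nonempty ∨ (Bk k).Nonempty) → ∃ (φ : V →ₗ[ℝ] ℝ) (ν : V → V)
      (H : AffineSubspace ℝ V) (Bt : Set (Finset V)), IsApex (e k) φ (e '' Ioi k) ν ∧ (∀ i, k < i → 1 < φ (e i - e k)) ∧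
      (∀ z, z ∈ H ↔ z ∈ W ∧ φ (z - e k) = 1) ∧ (H : Set V).Nonempty ∧
      IsRelativeBasis K d H (centralProj (e k) φ '' (e '' Ioi k)) Bt ∧
      Bk k = liftSimplex (e k) ν '' Bt) :
    IsRelativeBasis K (d + 1) W E (⋃ k, Bk k) := by
  have hIci : ∀ k, insert (e k) (e '' Ioi k) = e '' Ici k := fun k => by
    rw [← image_insert_eq, Ioi_insert]
  have hsub : ∀ k, ∀ σ ∈ Bk k, σ ∈ simplices (d + 1) (e '' Ici k) := by
    intro k σ hσ
    obtain ⟨φ, ν, H, Bt, hA, -, -, -, hBt, hBk⟩ := h k (Or.inr ⟨σ, hσ⟩)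
    rw [hBk] at hσ
    obtain ⟨τ, hτ, rfl⟩ := hσ
    rw [← hIci]
    exact hA.liftSimplex_mem_simplices (hBt.subset hτ)
  have hIciE : ∀ k, e '' Ici k ⊆ E := fun k => he ▸ image_subset_range _ _
  refine ⟨fun σ hσ => ?_, ?_, ?_⟩
  · obtain ⟨k, hk⟩ := mem_iUnion.mp hσ
    exact simplices_mono (hIciE k) (hsub k σ hk)
  -- Each simplex is filed under its first vertex.
  · have hlater : ∀ s : Set (Fin N), (∀ j ∈ s, ∀ σ ∈ simplices (d + 1) (e '' Ici j),
        Generated (systemF (d + 1) E) (⋃ k, Bk k) σ) →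
        ∀ σ ∈ simplices (d + 1) (e '' s), Generated (systemF (d + 1) E) (⋃ k, Bk k) σ := by
      intro s hs σ hσ
      have hne : (Finset.univ.filter fun i => i ∈ s ∧ e i ∈ σ).Nonempty := by
        obtain ⟨v, hv⟩ := Finset.card_pos.mp (by rw [hσ.2.1]; omega : 0 < σ.card)
        obtain ⟨i, hi, rfl⟩ := hσ.1 hv
        exact ⟨i, by simp [hi, Finset.mem_coe.mp hv]⟩
      obtain ⟨j, hj, hmin⟩ := Finset.exists_min_image _ id hne
      rw [Finset.mem_filter] at hj
      refine hs j hj.2.1 σ ⟨fun v hv => ?_, hσ.2⟩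
      obtain ⟨i, hi, rfl⟩ := hσ.1 hv
      exact ⟨i, hmin i (by simp [hi, Finset.mem_coe.mp hv]), rfl⟩
    have hgen : ∀ k, ∀ σ ∈ simplices (d + 1) (e '' Ici k),
        Generated (systemF (d + 1) E) (⋃ k, Bk k) σ := by
      intro k
      induction k using WellFoundedGT.induction with
      | _ k ih =>
        rw [← hIci]
        intro σ hσ
        by_cases hne : (Ioi k).Nonempty
        · obtain ⟨φ, ν, H, Bt, hA, -, -, -, hBt, hBk⟩ := h k (Or.inl hne)
          refine hA.generated ((hIci k).trans_subset (hIciE k)) (hlater _ fun j hj => ih j hj)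
            (fun τ hτ => mem_iUnion.mpr ⟨k, hBk ▸ mem_image_of_mem _ hτ⟩) hBt.generated σ hσ
        · exfalso
          rw [not_nonempty_iff_eq_empty.mp hne, image_empty, insert_empty_eq] at hσ
          have h1 : σ ⊆ {e k} := fun v hv => by simpa using hσ.1 hv
          have h2 := Finset.card_le_card h1
          rw [hσ.2.1, Finset.card_singleton] at h2
          omega
    have := hlater univ fun j _ => hgen j
    rwa [image_univ, he] at this
  · intro T c 𝒜 hTB h𝒜 h𝒜W hrel
    -- Increasing induction on `k`: earlier families already have zero coefficients, and simplices
    -- of later families have all their vertices beyond the section at `e k`.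
    have hzero : ∀ k, ∀ σ ∈ T, σ ∈ Bk k → c σ = 0 := by
      intro k
      induction k using WellFoundedLT.induction with
      | _ k ih =>
        intro σ hσ hσk
        obtain ⟨φ, ν, H, Bt, hA, hφ, hH, hne, hBt, hBk⟩ := h k (Or.inr ⟨σ, hσk⟩)
        rw [hBk] at hσk
        obtain ⟨τ, hτ, rfl⟩ := hσk
        refine hA.coeff_eq_zero (hEW (he ▸ mem_range_self k)) hH hne hBt h𝒜 h𝒜W hrel
          (fun σ' hσ' => ?_) τ hτ hσ
        obtain ⟨m, hm⟩ := mem_iUnion.mp (hTB hσ')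
        rcases lt_trichotomy m k with hmk | rfl | hmk
        · exact Or.inl (ih m hmk σ' hσ' hm)
        · rw [hBk] at hm
          exact Or.inr (Or.inl hm)
        · refine Or.inr (Or.inr fun v hv => ?_)
          obtain ⟨i, hi, rfl⟩ := (hsub m σ' hm).1 hv
          exact hφ i (hmk.trans_le hi)
    intro σ hσ
    obtain ⟨k, hk⟩ := mem_iUnion.mp (hTB hσ)
    exact hzero k σ hσ hk

/-! ### Finite sets on a line -/

theorem sbtw_iff_exists_add_smul {p r q : V} :
    Sbtw ℝ p r q ↔ p ≠ q ∧ ∃ s : ℝ, 0 < s ∧ s < 1 ∧ r = p + s • (q - p) := by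
  rw [sbtw_iff_mem_image_Ioo_and_ne, and_comm]
  refine and_congr_right fun _ => ?_
  simp only [mem_image, mem_Ioo, AffineMap.lineMap_apply, vsub_eq_sub, vadd_eq_add, and_assoc,
    add_comm p, eq_comm]

theorem sbtw_add_smul {p v : V} (hv : v ≠ 0) {a b c : ℝ} (hac : a < c) (hcb : c < b) :
    Sbtw ℝ (p + a • v) (p + c • v) (p + b • v) := by
  have hab : b - a ≠ 0 := by linarith
  have hab' : 0 < b - a := by linarith
  have e : p + b • v - (p + a • v) = (b - a) • v := by rw [sub_smul]; abel
  rw [sbtw_iff_exists_add_smul, e]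
  refine ⟨fun h => ?_, (c - a) / (b - a), div_pos (by linarith) hab',
    (div_lt_one hab').mpr (by linarith), ?_⟩
  · rw [h, sub_self, eq_comm, smul_eq_zero] at e
    exact e.elim hab hv
  · rw [smul_smul, div_mul_cancel₀ _ hab, sub_smul]
    abel

/-- The pairs of neighbouring points of a set of points on a line. -/
def neighbourPairs (P : Set V) : Set (Finset V) :=
  {τ | ∃ p ∈ P, ∃ q ∈ P, p ≠ q ∧ (∀ r ∈ P, ¬ Sbtw ℝ p r q) ∧ τ = {p, q}}

theorem pair_mem_simplices {P : Set V} {p q : V} (hp : p ∈ P) (hq : q ∈ P) (hpq : p ≠ q) :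
    ({p, q} : Finset V) ∈ simplices 1 P := by
  refine ⟨?_, Finset.card_pair hpq, ?_⟩
  · rw [Finset.coe_pair]
    exact pair_subset hp hq
  · rw [affineIndependent_finset_iff]
    intro w w1 w2
    rw [Finset.sum_pair hpq] at w1 w2
    have hwq : w q = -w p := by linarith
    rw [hwq, neg_smul, ← sub_eq_add_neg, ← smul_sub, smul_eq_zero,
      or_iff_left (sub_ne_zero.mpr hpq)] at w2
    intro v hv
    rcases Finset.mem_insert.mp hv with rfl | hv
    · exact w2
    · rw [Finset.mem_singleton.mp hv, hwq, w2, neg_zero]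

/-- A point `r` of `P` between `p` and `q` splits the pair into two with fewer points between; the
relation on `{p, q, r}` then yields `{p, q}`. -/
theorem generated_neighbourPairs {P : Set V} (hP : P.Finite) :
    ∀ (m : ℕ) (p q : V), p ∈ P → q ∈ P → p ≠ q → {r ∈ P | Sbtw ℝ p r q}.ncard = m →
      Generated (systemF 1 P) (neighbourPairs P) {p, q} := by
  intro m
  induction m using Nat.strong_induction_on with
  | _ m ih =>
    intro p q hp hq hpq hm
    by_cases hr : ∃ r ∈ P, Sbtw ℝ p r q
    · obtain ⟨r, hr, hprq⟩ := hr
      have hfin : {s ∈ P | Sbtw ℝ p s q}.Finite := hP.sep _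
      have hpr : Generated (systemF 1 P) (neighbourPairs P) {p, r} := by
        refine ih _ ?_ p r hp hr hprq.left_ne rfl
        rw [← hm]
        refine ncard_lt_ncard ⟨fun s hs => ⟨hs.1, hprq.trans_left hs.2⟩, fun h => ?_⟩ hfin
        exact (h ⟨hr, hprq⟩).2.ne_right rfl
      have hqr : Generated (systemF 1 P) (neighbourPairs P) {q, r} := by
        refine ih _ ?_ q r hq hr hprq.ne_right.symm rfl
        rw [← hm]
        refine ncard_lt_ncard ⟨fun s hs => ⟨hs.1, (hprq.symm.trans_left hs.2).symm⟩,
          fun h => ?_⟩ hfin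
        exact (h ⟨hr, hprq⟩).2.ne_right rfl
      have hpS : p ∉ ({q, r} : Finset V) := by simp [hpq, hprq.left_ne]
      have hqr' : q ≠ r := hprq.ne_right.symm
      have hS : ({p, q, r} : Finset V).card = 3 := by
        rw [Finset.card_insert_of_notMem hpS, Finset.card_pair hqr']
      have hpq' := pair_mem_simplices hp hq hpq
      have hsub : ({p, q} : Finset V) ⊆ {p, q, r} := by
        intro v; simp only [Finset.mem_insert, Finset.mem_singleton]; tauto
      refine Generated.step (f := simplicesOn 1 P {p, q, r}) ⟨_, ?_, hS, ⟨_, hsub, hpq'.2⟩, rfl⟩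
        ⟨hpq', hsub⟩ ?_
      · intro v hv
        simp only [Finset.coe_insert, Finset.coe_singleton, mem_insert_iff, mem_singleton_iff] at hv
        rcases hv with rfl | rfl | rfl <;> assumption
      · rintro τ ⟨hτ, hτS⟩ hne
        obtain ⟨u, hu⟩ : ∃ u, ({p, q, r} : Finset V) \ τ = {u} := by
          rw [← Finset.card_eq_one, Finset.card_sdiff_of_subset hτS, hS, hτ.2.1]
        have huτ : τ = ({p, q, r} : Finset V).erase u := by
          rw [← Finset.sdiff_singleton_eq_erase, ← hu, Finset.sdiff_sdiff_eq_self hτS]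
        have huS : u ∈ ({p, q, r} : Finset V) :=
          (Finset.mem_sdiff.mp (hu ▸ Finset.mem_singleton_self u)).1
        have hrp := hprq.ne_left
        simp only [Finset.mem_insert, Finset.mem_singleton] at huS
        rcases huS with rfl | rfl | rfl
        · rwa [huτ, Finset.erase_insert hpS]
        · have : ({p, u, r} : Finset V).erase u = {p, r} := by
            ext v
            simp only [Finset.mem_erase, Finset.mem_insert, Finset.mem_singleton]
            constructor
            · tauto
            · rintro (rfl | rfl)
              · exact ⟨hpq, Or.inl rfl⟩
              · exact ⟨hqr'.symm, Or.inr (Or.inr rfl)⟩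
          rwa [huτ, this]
        · refine absurd ?_ hne
          rw [huτ]
          ext v
          simp only [Finset.mem_erase, Finset.mem_insert, Finset.mem_singleton]
          constructor
          · tauto
          · rintro (rfl | rfl)
            · exact ⟨hrp.symm, Or.inl rfl⟩
            · exact ⟨hqr', Or.inr (Or.inl rfl)⟩
    · exact .base ⟨p, hp, q, hq, hpq, fun r hr' h => hr ⟨r, hr', h⟩, rfl⟩

/-- A generic point between two neighbours lies in no other neighbour segment, so evaluating there
isolates one coefficient. -/
theorem isRelativeBasis_neighbourPairs (K : Type*) [Field K] [FiniteDimensional ℝ V]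
    {H : AffineSubspace ℝ V} (hH : finrank ℝ H.direction ≤ 1) {P : Set V} (hP : P.Finite)
    (hPH : P ⊆ H) : IsRelativeBasis K 1 H P (neighbourPairs P) := by
  refine ⟨?_, ?_, ?_⟩
  · rintro τ ⟨p, hp, q, hq, hpq, -, rfl⟩
    exact pair_mem_simplices hp hq hpq
  · intro σ hσ
    obtain ⟨p, q, hpq, rfl⟩ := Finset.card_eq_two.mp hσ.2.1
    exact generated_neighbourPairs hP _ p q (hσ.1 (by simp)) (hσ.1 (by simp)) hpq rfl
  · intro T c 𝒜 hT h𝒜 h𝒜H hrel σ hσ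
    obtain ⟨p, hp, q, hq, hpq, hno, rfl⟩ := hT hσ
    have hv : q - p ≠ 0 := sub_ne_zero.mpr hpq.symm
    have hparam : ∀ u ∈ H, ∃ t : ℝ, u = p + t • (q - p) := by
      obtain ⟨v, hvv⟩ := finrank_le_one_iff.mp hH
      intro u hu
      obtain ⟨a, ha⟩ := hvv ⟨q - p, H.vsub_mem_direction (hPH hq) (hPH hp)⟩
      obtain ⟨b, hb⟩ := hvv ⟨u - p, H.vsub_mem_direction hu (hPH hp)⟩
      have ha' : a • (v : V) = q - p := congrArg Subtype.val ha
      have hb' : b • (v : V) = u - p := congrArg Subtype.val hb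
      have ha0 : a ≠ 0 := fun h => hv (by rw [← ha', h, zero_smul])
      refine ⟨b / a, ?_⟩
      rw [← ha', smul_smul, div_mul_cancel₀ _ ha0, hb']
      abel
    -- A subspace containing two points of the line contains all of `H`, so each proper one excludes
    -- at most one parameter.
    have hbad : (⋃ A ∈ 𝒜, {t : ℝ | p + t • (q - p) ∈ A}).Finite := by
      refine h𝒜.biUnion fun A hA => Set.Subsingleton.finite fun t ht t' ht' => ?_
      by_contra hne
      refine (h𝒜H A hA).not_ge fun u hu => ?_
      obtain ⟨s, rfl⟩ := hparam u hu
      have hne' : t' - t ≠ 0 := sub_ne_zero.mpr (Ne.symm hne)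
      have := A.smul_vsub_vadd_mem ((s - t) / (t' - t)) ht' ht ht
      have e : p + t' • (q - p) - (p + t • (q - p)) = (t' - t) • (q - p) := by
        rw [sub_smul]; abel
      rw [vsub_eq_sub, vadd_eq_add, e, smul_smul, div_mul_cancel₀ _ hne', sub_smul] at this
      convert this using 1
      abel
    obtain ⟨t, ⟨ht0, ht1⟩, htbad⟩ := ((Ioo_infinite (zero_lt_one (α := ℝ))).sdiff hbad).nonempty
    have htA : ∀ A ∈ 𝒜, p + t • (q - p) ∉ A := fun A hA h =>
      htbad (mem_iUnion₂.mpr ⟨A, hA, h⟩)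
    have hzH : p + t • (q - p) ∈ H := by
      have := H.smul_vsub_vadd_mem t (hPH hq) (hPH hp) (hPH hp)
      simpa [add_comm] using this
    have hother : ∀ τ ∈ T, p + t • (q - p) ∈ convexHull ℝ (τ : Set V) → τ = {p, q} := by
      intro τ hτ hmem
      obtain ⟨a, ha, b, hb, hab, hnoab, rfl⟩ := hT hτ
      obtain ⟨α, hα⟩ := hparam a (hPH ha)
      obtain ⟨β, hβ⟩ := hparam b (hPH hb)
      rw [Finset.coe_pair, convexHull_pair, segment_eq_image_lineMap] at hmem
      obtain ⟨s, ⟨hs0, hs1⟩, hs⟩ := hmem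
      have ht : t = α + s * (β - α) := by
        have e : (α + s * (β - α)) • (q - p) = t • (q - p) := by
          rw [AffineMap.lineMap_apply, hα, hβ, vsub_eq_sub, vadd_eq_add] at hs
          rw [add_smul, mul_smul, sub_smul]
          have e1 : p + β • (q - p) - (p + α • (q - p)) = β • (q - p) - α • (q - p) := by abel
          rw [e1] at hs
          have e2 := congrArg (fun y => y - p) hs
          simp only [add_sub_cancel_left] at e2
          rw [← e2]
          abel
        exact (smul_left_injective ℝ hv e).symm
      have hp0 : p = p + (0 : ℝ) • (q - p) := by simp
      have hq1 : q = p + (1 : ℝ) • (q - p) := by simp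
      have hno' : ∀ γ : ℝ, p + γ • (q - p) ∈ P → ¬ (0 < γ ∧ γ < 1) := fun γ hγ h => by
        have := sbtw_add_smul (p := p) hv h.1 h.2
        rw [← hp0, ← hq1] at this
        exact hno _ hγ this
      have hnoα := hno' α (hα ▸ ha)
      have hnoβ := hno' β (hβ ▸ hb)
      have hnoab' : ∀ γ : ℝ, p + γ • (q - p) ∈ P → ¬ (α < γ ∧ γ < β) := fun γ hγ h => by
        have := sbtw_add_smul (p := p) hv h.1 h.2
        rw [← hα, ← hβ] at this
        exact hnoab _ hγ this
      have hnoba' : ∀ γ : ℝ, p + γ • (q - p) ∈ P → ¬ (β < γ ∧ γ < α) := fun γ hγ h => by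
        have := sbtw_add_smul (p := p) hv h.1 h.2
        rw [← hα, ← hβ] at this
        exact hnoab _ hγ this.symm
      have h1 := hnoab' 0 (hp0 ▸ hp)
      have h2 := hnoab' 1 (hq1 ▸ hq)
      have h3 := hnoba' 0 (hp0 ▸ hp)
      have h4 := hnoba' 1 (hq1 ▸ hq)
      -- Neither endpoint parameter lies in `(0, 1)`, yet `t` is between them, so they enclose `[0,
      -- 1]`. As neither `0` nor `1` lies strictly between them, they equal `0` and `1`.
      rcases le_total α β with hαβ | hαβ
      · have hαt : α ≤ t := by nlinarith
        have htβ : t ≤ β := by nlinarith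
        have hα0 : α ≤ 0 := by by_contra h; exact hnoα ⟨not_le.mp h, by linarith⟩
        have hβ1 : 1 ≤ β := by by_contra h; exact hnoβ ⟨by linarith, not_le.mp h⟩
        have : α = 0 := by
          by_contra h
          exact h1 ⟨lt_of_le_of_ne hα0 h, by linarith⟩
        have : β = 1 := by
          by_contra h
          exact h2 ⟨by linarith, lt_of_le_of_ne hβ1 (Ne.symm h)⟩
        subst_vars
        simp
      · have hαt : t ≤ α := by nlinarith
        have htβ : β ≤ t := by nlinarith
        have hα0 : β ≤ 0 := by by_contra h; exact hnoβ ⟨not_le.mp h, by linarith⟩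
        have hβ1 : 1 ≤ α := by by_contra h; exact hnoα ⟨by linarith, not_le.mp h⟩
        have : β = 0 := by
          by_contra h
          exact h3 ⟨lt_of_le_of_ne hα0 h, by linarith⟩
        have : α = 1 := by
          by_contra h
          exact h4 ⟨by linarith, lt_of_le_of_ne hβ1 (Ne.symm h)⟩
        subst_vars
        simp [Finset.pair_comm]
    have hsum := hrel _ hzH htA
    rw [Finset.sum_eq_single_of_mem _ hσ fun τ hτ hne => by
      rw [if_neg fun h => hne (hother τ hτ h), mul_zero], if_pos, mul_one] at hsum
    · exact hsum
    · rw [Finset.coe_pair, convexHull_pair, segment_eq_image_lineMap]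
      exact ⟨t, ⟨ht0.le, ht1.le⟩, by
        rw [AffineMap.lineMap_apply, vsub_eq_sub, vadd_eq_add, add_comm]⟩

/-! ### Nearest points on the rays -/

theorem openRay_add_smul {x z : V} {s : ℝ} (hs : 0 < s) :
    openRay x (x + s • (z - x)) = openRay x z := by
  have aux : ∀ {p q : V} {r : ℝ}, 0 < r → q - x = r • (p - x) → openRay x q ⊆ openRay x p := by
    rintro p q r hr e y ⟨t, ht, rfl⟩
    refine ⟨t * r, mul_pos ht hr, ?_⟩
    rw [AffineMap.lineMap_apply, AffineMap.lineMap_apply, vsub_eq_sub, vsub_eq_sub, e, smul_smul]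
  refine Subset.antisymm (aux hs (add_sub_cancel_left _ _)) (aux (inv_pos.mpr hs) ?_)
  rw [add_sub_cancel_left, inv_smul_smul₀ hs.ne']

theorem openRay_centralProj {x y : V} {φ : V →ₗ[ℝ] ℝ} (hy : 0 < φ (y - x)) :
    openRay x (centralProj x φ y) = openRay x y :=
  openRay_add_smul (inv_pos.mpr hy)

theorem mem_openRay_iff {x p y : V} : y ∈ openRay x p ↔ ∃ t : ℝ, 0 < t ∧ y = x + t • (p - x) := by
  simp only [openRay, mem_ofPred_eq, AffineMap.lineMap_apply, vsub_eq_sub, vadd_eq_add, add_comm x]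

theorem IsNearestOnRay.congr {E : Set V} {x p q y : V} (h : openRay x p = openRay x q) :
    IsNearestOnRay E x p y ↔ IsNearestOnRay E x q y := by
  rw [IsNearestOnRay, IsNearestOnRay, h]

section Ordering

variable {E : Set V} {N : ℕ} {e : Fin N → V} {k : Fin N} {φ : V →ₗ[ℝ] ℝ}

/-- The nearest point is sought in all of `E`, and this keeps it among the later points. An earlier
`e m` before or at `e i` on the ray would lie in the hull of the later points `e k` and `e i`; one
beyond it would put `e i` into the hull of `e m` and `e k`. -/
theorem IsAdmissibleOrdering.lt_of_mem_openRay (he : IsAdmissibleOrdering E e) {i m : Fin N}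
    (hki : k < i) (hm : e m ∈ openRay (e k) (e i)) : k < m := by
  obtain ⟨t, ht, hmt⟩ := mem_openRay_iff.mp hm
  have hki' : e i - e k ≠ 0 := sub_ne_zero.mpr fun h => hki.ne' (he.injective h)
  by_contra hkm
  rcases (not_lt.mp hkm).lt_or_eq with hmk | rfl
  · rcases le_total t 1 with ht1 | ht1
    · refine (he.disjoint m).le_bot ⟨subset_convexHull ℝ _ (mem_image_of_mem e self_mem_Iic), ?_⟩
      rw [hmt]
      exact (convex_convexHull ℝ _).add_smul_sub_mem
        (subset_convexHull ℝ _ (mem_image_of_mem e (mem_Ioi.mpr hmk)))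
        (subset_convexHull ℝ _ (mem_image_of_mem e (mem_Ioi.mpr (hmk.trans hki)))) ⟨ht.le, ht1⟩
    · refine (he.disjoint k).le_bot
        ⟨?_, subset_convexHull ℝ _ (mem_image_of_mem e (mem_Ioi.mpr hki))⟩
      have hi : e i = e k + t⁻¹ • (e m - e k) := by
        rw [hmt, add_sub_cancel_left, inv_smul_smul₀ ht.ne', add_sub_cancel]
      rw [hi]
      exact (convex_convexHull ℝ _).add_smul_sub_mem
        (subset_convexHull ℝ _ (mem_image_of_mem e self_mem_Iic))
        (subset_convexHull ℝ _ (mem_image_of_mem e (mem_Iic.mpr hmk.le)))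
        ⟨(inv_pos.mpr ht).le, inv_le_one_of_one_le₀ ht1⟩
  · rw [eq_comm, add_eq_left, smul_eq_zero] at hmt
    exact hmt.elim ht.ne' hki'

theorem IsNearestOnRay.unique {x p y z : V} (hp : p ≠ x) (hy : IsNearestOnRay E x p y)
    (hz : IsNearestOnRay E x p z) : y = z := by
  have hd := le_antisymm (hy.2.2 z hz.1 hz.2.1) (hz.2.2 y hy.1 hy.2.1)
  obtain ⟨s, hs, rfl⟩ := mem_openRay_iff.mp hy.2.1
  obtain ⟨t, ht, rfl⟩ := mem_openRay_iff.mp hz.2.1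
  rw [dist_self_add_right, dist_self_add_right, norm_smul, norm_smul, Real.norm_of_nonneg hs.le,
    Real.norm_of_nonneg ht.le] at hd
  rw [mul_right_cancel₀ (norm_ne_zero_iff.mpr (sub_ne_zero.mpr hp)) hd]

/-- The choice of the nearest point on every ray from `e k` through a later point. -/
theorem IsAdmissibleOrdering.exists_isApex (he : IsAdmissibleOrdering E e)
    (hφ : ∀ i, k < i → 1 < φ (e i - e k)) :
    ∃ ν : V → V, IsApex (e k) φ (e '' Ioi k) ν ∧
      ∀ p ∈ centralProj (e k) φ '' (e '' Ioi k), ∀ y, IsNearestOnRay E (e k) p y ↔ y = ν p := by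
  have hpos : ∀ i, k < i → 0 < φ (e i - e k) := fun i hi => one_pos.trans (hφ i hi)
  have hex : ∀ p ∈ centralProj (e k) φ '' (e '' Ioi k), ∃ m, k < m ∧
      IsNearestOnRay E (e k) p (e m) := by
    rintro _ ⟨_, ⟨i, hi, rfl⟩, rfl⟩
    have hray := openRay_centralProj (hpos i hi)
    have hself : e i ∈ openRay (e k) (e i) := mem_openRay_iff.mpr ⟨1, one_pos, by simp⟩
    obtain ⟨m, hm, hmin⟩ := Finset.exists_min_image
      (Finset.univ.filter fun m => e m ∈ openRay (e k) (e i)) (fun m => dist (e k) (e m))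
      ⟨i, by simpa using hself⟩
    rw [Finset.mem_filter] at hm
    refine ⟨m, he.lt_of_mem_openRay hi hm.2, (IsNearestOnRay.congr hray).mpr
      ⟨he.range_eq ▸ mem_range_self m, hm.2, ?_⟩⟩
    intro z hz hzr
    rw [← he.range_eq] at hz
    obtain ⟨l, rfl⟩ := hz
    exact hmin l (by simpa using hzr)
  have hp1 : ∀ p ∈ centralProj (e k) φ '' (e '' Ioi k), φ (p - e k) = 1 := by
    rintro _ ⟨_, ⟨i, hi, rfl⟩, rfl⟩
    exact apply_centralProj_sub (hpos i hi)
  have hne : ∀ p ∈ centralProj (e k) φ '' (e '' Ioi k), p ≠ e k := fun p hp h => by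
    have := hp1 p hp
    rw [h, sub_self, map_zero] at this
    exact zero_ne_one this
  have : Nonempty (Fin N) := ⟨k⟩
  choose! m hm hnear using hex
  refine ⟨fun p => e (m p), ⟨?_, fun p hp => mem_image_of_mem e (hm p hp), fun p hp => ?_⟩,
    fun p hp y => ⟨fun hy => hy.unique (hne p hp) (hnear p hp), fun h => h ▸ hnear p hp⟩⟩
  · rintro _ ⟨i, hi, rfl⟩
    exact hpos i hi
  · obtain ⟨t, ht, hmt⟩ := mem_openRay_iff.mp (hnear p hp).2.1
    simp only [centralProj]
    rw [hmt, add_sub_cancel_left, map_smul, hp1 p hp, smul_eq_mul, mul_one, inv_smul_smul₀ ht.ne',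
      add_sub_cancel]

theorem isMu_iff {ν : V → V} {P : Set V} {x : V}
    (hν : ∀ p ∈ P, ∀ y, IsNearestOnRay E x p y ↔ y = ν p)
    {τ σ : Finset V} (hτ : (τ : Set V) ⊆ P) : IsMu E x τ σ ↔ σ = liftSimplex x ν τ := by
  have : {y | ∃ p ∈ τ, IsNearestOnRay E x p y} = ((τ.image ν : Finset V) : Set V) := by
    ext y
    rw [Finset.coe_image]
    exact exists_congr fun p => and_congr_right fun hp => (hν p (hτ hp) y).trans eq_comm
  rw [IsMu, this, ← Finset.coe_insert, Finset.coe_inj, liftSimplex]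

end Ordering

/-! ### Sections of an affine subspace -/

/-- The section of `W` by the hyperplane `φ (· - x) = 1`. -/
def levelSection (W : AffineSubspace ℝ V) (x : V) (φ : V →ₗ[ℝ] ℝ) : AffineSubspace ℝ V where
  carrier := {z | z ∈ W ∧ φ (z - x) = 1}
  smul_vsub_vadd_mem' c p q r hp hq hr := by
    refine ⟨W.smul_vsub_vadd_mem c hp.1 hq.1 hr.1, ?_⟩
    have h1 := hp.2
    have h2 := hq.2
    have h3 := hr.2
    simp only [map_sub] at h1 h2 h3
    simp only [vsub_eq_sub, vadd_eq_add, map_sub, map_add, map_smul, smul_eq_mul]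
    rw [show φ p - φ q = 0 by linarith]
    linarith

theorem mem_levelSection {W : AffineSubspace ℝ V} {x z : V} {φ : V →ₗ[ℝ] ℝ} :
    z ∈ levelSection W x φ ↔ z ∈ W ∧ φ (z - x) = 1 := Iff.rfl

theorem direction_inf_ker_lt {W : AffineSubspace ℝ V} {x y : V} {φ : V →ₗ[ℝ] ℝ} (hx : x ∈ W)
    (hy : y ∈ W) (hφ : φ (y - x) ≠ 0) : W.direction ⊓ φ.ker < W.direction := by
  refine lt_of_le_of_ne inf_le_left fun h => hφ ?_
  have hmem := W.vsub_mem_direction hy hx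
  rw [← h] at hmem
  exact hmem.2

theorem direction_le_inf_ker {W H : AffineSubspace ℝ V} {x : V} {φ : V →ₗ[ℝ] ℝ}
    (hH : ∀ z ∈ H, z ∈ W ∧ φ (z - x) = 1) : H.direction ≤ W.direction ⊓ φ.ker := by
  rw [AffineSubspace.direction, vectorSpan, Submodule.span_le]
  rintro _ ⟨p, hp, q, hq, rfl⟩
  refine ⟨W.vsub_mem_direction (hH p hp).1 (hH q hq).1, ?_⟩
  have h1 := (hH p hp).2
  have h2 := (hH q hq).2
  rw [map_sub] at h1 h2
  change φ (p - q) = 0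
  rw [map_sub]
  linarith

theorem centralProj_mem {W : AffineSubspace ℝ V} {x y : V} {φ : V →ₗ[ℝ] ℝ} (hx : x ∈ W)
    (hy : y ∈ W) : centralProj x φ y ∈ W := by
  have := W.smul_vsub_vadd_mem (φ (y - x))⁻¹ hy hx hx
  rwa [vsub_eq_sub, vadd_eq_add, add_comm] at this

/-! ### The two cases of the algorithm -/

/-- On the line `φ (· - e k) = 1` the rays become points, and lying strictly inside an angle becomes
strict betweenness. The planar rule is thus the general lift applied to neighbouring points on a
line. -/
theorem planeTriangles_eq {E : Set V} {N : ℕ} {e : Fin N → V} {k : Fin N} {φ : V →ₗ[ℝ] ℝ}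
    {ν : V → V} (hA : IsApex (e k) φ (e '' Ioi k) ν)
    (hν : ∀ p ∈ centralProj (e k) φ '' (e '' Ioi k), ∀ y, IsNearestOnRay E (e k) p y ↔ y = ν p) :
    planeTriangles E e k =
      liftSimplex (e k) ν '' neighbourPairs (centralProj (e k) φ '' (e '' Ioi k)) := by
  set x := e k with hx
  have hpos : ∀ i, k < i → 0 < φ (e i - x) := fun i hi => hA.pos _ (mem_image_of_mem e hi)
  have hsub : ∀ i, k < i → e i - x = φ (e i - x) • (centralProj x φ (e i) - x) := fun i hi =>
    (smul_centralProj_sub (hpos i hi)).symm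
  have hmemP : ∀ i, k < i → centralProj x φ (e i) ∈ centralProj x φ '' (e '' Ioi k) := fun i hi =>
    mem_image_of_mem _ (mem_image_of_mem e hi)
  have hbetween : ∀ i j m, k < i → k < j → k < m →
      centralProj x φ (e i) ≠ centralProj x φ (e j) →
      ((∃ a b : ℝ, 0 < a ∧ 0 < b ∧ e m - x = a • (e i - x) + b • (e j - x)) ↔
        Sbtw ℝ (centralProj x φ (e i)) (centralProj x φ (e m)) (centralProj x φ (e j))) := by
    intro i j m hi hj hm hij
    have pi := hpos i hi
    have pj := hpos j hj
    have pm := hpos m hm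
    rw [sbtw_iff_exists_add_smul]
    constructor
    · rintro ⟨a, b, ha, hb, hab⟩
      -- The coefficients `a` and `b`, rescaled by the values of `φ`, become convex weights; this is
      -- the weight of the projection of `e j`.
      refine ⟨hij, b * φ (e j - x) / φ (e m - x), by positivity, ?_, ?_⟩
      · rw [div_lt_one pm, hab, map_add, map_smul, map_smul, smul_eq_mul, smul_eq_mul]
        nlinarith
      · have h1 : φ (e m - x) = a * φ (e i - x) + b * φ (e j - x) := by
          rw [hab, map_add, map_smul, map_smul, smul_eq_mul, smul_eq_mul]
        have h2 : φ (e m - x) • (centralProj x φ (e m) - x) =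
            (a * φ (e i - x)) • (centralProj x φ (e i) - x) +
            (b * φ (e j - x)) • (centralProj x φ (e j) - x) := by
          rw [← hsub m hm, mul_smul, mul_smul, ← hsub i hi, ← hsub j hj, hab]
        have h3 : a * φ (e i - x) = φ (e m - x) - b * φ (e j - x) := by linarith
        apply sub_left_injective (b := x)
        apply smul_right_injective V pm.ne'
        simp only
        rw [h2, h3, add_sub_right_comm, smul_add, smul_smul, mul_div_cancel₀ _ pm.ne']
        module
    · rintro ⟨-, s, hs0, hs1, hs⟩
      refine ⟨φ (e m - x) * (1 - s) / φ (e i - x), φ (e m - x) * s / φ (e j - x),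
        div_pos (mul_pos pm (by linarith)) pi, by positivity, ?_⟩
      have hscale : ∀ (l : Fin N) (r : ℝ),
          (r / φ (e l - x)) • (e l - x) = r • (centralProj x φ (e l) - x) := fun l r => by
        rw [div_eq_mul_inv, mul_smul, centralProj, add_sub_cancel_left]
      refine (hsub m hm).trans ?_
      rw [hs, hscale, hscale]
      module
  have hraymem : ∀ i j, k < i → k < j →
      (e j ∈ openRay x (e i) ↔ centralProj x φ (e i) = centralProj x φ (e j)) := by
    intro i j hi hj
    constructor
    · rw [mem_openRay_iff]
      rintro ⟨t, ht, h⟩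
      rw [centralProj, centralProj, h, add_sub_cancel_left, map_smul, smul_smul, smul_eq_mul,
        mul_inv_rev, mul_assoc, inv_mul_cancel₀ ht.ne', mul_one]
    · intro h
      rw [← openRay_centralProj (hpos i hi), h, openRay_centralProj (hpos j hj), mem_openRay_iff]
      exact ⟨1, one_pos, by simp⟩
  have hlift : ∀ p q, liftSimplex x ν {p, q} = {x, ν p, ν q} := fun p q => by
    rw [liftSimplex, Finset.image_insert, Finset.image_singleton]
  ext σ
  constructor
  · rintro ⟨i, j, ⟨hi, hj, hij, hno⟩, hni, hnj, hσ⟩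
    rw [hraymem i j hi hj] at hij
    rw [IsNearestOnRay.congr (openRay_centralProj (hpos i hi)).symm, hν _ (hmemP i hi)] at hni
    rw [IsNearestOnRay.congr (openRay_centralProj (hpos j hj)).symm, hν _ (hmemP j hj)] at hnj
    refine ⟨{centralProj x φ (e i), centralProj x φ (e j)},
      ⟨_, hmemP i hi, _, hmemP j hj, hij, ?_, rfl⟩, ?_⟩
    · rintro _ ⟨_, ⟨m, hm, rfl⟩, rfl⟩ h
      exact hno ⟨m, hm, (hbetween i j m hi hj hm hij).mpr h⟩
    · rw [hlift, ← hni, ← hnj, ← Finset.coe_inj, hσ]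
      simp [hx]
  · rintro ⟨_, ⟨p, hp, q, hq, hpq, hno, rfl⟩, rfl⟩
    obtain ⟨i, hi, hip⟩ := hA.mem p hp
    obtain ⟨j, hj, hjq⟩ := hA.mem q hq
    have hi' : k < i := hi
    have hj' : k < j := hj
    have hpi : centralProj x φ (e i) = p := by rw [hip, hA.proj p hp]
    have hqj : centralProj x φ (e j) = q := by rw [hjq, hA.proj q hq]
    refine ⟨i, j, ⟨hi, hj, ?_, ?_⟩, ?_, ?_, ?_⟩
    · rw [hraymem i j hi' hj', hpi, hqj]
      exact hpq
    · rintro ⟨m, hm, h⟩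
      rw [hbetween i j m hi' hj' hm (by rwa [hpi, hqj]), hpi, hqj] at h
      exact hno _ (hmemP m hm) h
    · rw [IsNearestOnRay.congr (openRay_centralProj (hpos i hi)).symm, hν _ (hmemP i hi), hpi, hip]
    · rw [IsNearestOnRay.congr (openRay_centralProj (hpos j hj)).symm, hν _ (hmemP j hj), hqj, hjq]
    · rw [hlift, ← hip, ← hjq]
      simp [hx]

theorem isRelativeBasis_plane [FiniteDimensional ℝ V] (K : Type*) [Field K]
    {W : AffineSubspace ℝ V} {E : Set V} (hW : finrank ℝ W.direction = 2) (hEW : E ⊆ W)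
    {N : ℕ} {e : Fin N → V} (he : IsAdmissibleOrdering E e) :
    IsRelativeBasis K 2 W E (⋃ k, planeTriangles E e k) := by
  have heW : ∀ i, e i ∈ W := fun i => hEW (he.range_eq ▸ mem_range_self i)
  refine isRelativeBasis_of_isApex hEW he.range_eq fun k hk => ?_
  obtain ⟨i₀, hi₀⟩ : (Ioi k).Nonempty := by
    rcases hk with hk | ⟨σ, i, j, hij, -⟩
    · exact hk
    · exact ⟨i, hij.1⟩
  obtain ⟨f, u, v, hu, huv, hv⟩ := geometric_hahn_banach_compact_closed (convex_convexHull ℝ _)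
    (((toFinite (Iic k)).image e).isCompact_convexHull ℝ) (convex_convexHull ℝ _)
    (((toFinite (Ioi k)).image e).isCompact_convexHull ℝ).isClosed (he.disjoint k)
  have hku : f (e k) < u := hu _ (subset_convexHull ℝ _ (mem_image_of_mem e self_mem_Iic))
  -- The scaling turns the separating level `f = u` into `φ (· - e k) = 1`, so later points have
  -- values above `1`.
  set φ : V →ₗ[ℝ] ℝ := (u - f (e k))⁻¹ • (f : V →ₗ[ℝ] ℝ) with hφdef
  have hφ : ∀ i, k < i → 1 < φ (e i - e k) := by
    intro i hi
    have := hv _ (subset_convexHull ℝ _ (mem_image_of_mem e (mem_Ioi.mpr hi)))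
    have hpos : 0 < u - f (e k) := by linarith
    rw [hφdef, LinearMap.smul_apply, smul_eq_mul, ContinuousLinearMap.coe_coe, map_sub,
      inv_mul_eq_div, one_lt_div hpos]
    linarith
  obtain ⟨ν, hA, hν⟩ := he.exists_isApex hφ
  have hPH : centralProj (e k) φ '' (e '' Ioi k) ⊆ levelSection W (e k) φ := by
    rintro _ ⟨_, ⟨i, hi, rfl⟩, rfl⟩
    exact ⟨centralProj_mem (heW k) (heW i),
      apply_centralProj_sub (one_pos.trans (hφ i hi))⟩
  refine ⟨φ, ν, levelSection W (e k) φ, neighbourPairs _, hA, hφ, fun z => mem_levelSection,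
    ⟨_, hPH (mem_image_of_mem _ (mem_image_of_mem e hi₀))⟩,
    isRelativeBasis_neighbourPairs K ?_ (((toFinite (Ioi k)).image e).image _) hPH,
    planeTriangles_eq hA hν⟩
  have h1 := Submodule.finrank_mono (direction_le_inf_ker (W := W) (H := levelSection W (e k) φ)
    (x := e k) (φ := φ) fun z hz => hz)
  have h2 := Submodule.finrank_lt_finrank_of_lt
    (direction_inf_ker_lt (heW k) (heW i₀) (one_pos.trans (hφ i₀ hi₀)).ne')
  omega

theorem isRelativeBasis_step [FiniteDimensional ℝ V] {K : Type*} [Field K] {d : ℕ}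
    {W : AffineSubspace ℝ V} {E : Set V} (hW : finrank ℝ W.direction = d + 1) (hEW : E ⊆ W)
    {N : ℕ} {e : Fin N → V} (he : IsAdmissibleOrdering E e)
    {H : Fin N → AffineSubspace ℝ V} (hHW : ∀ k, H k ≤ W)
    (hH : ∀ k, finrank ℝ (H k).direction = d)
    (hsep : ∀ k, Separates (H k) (initialHull e k) (finalHull e k))
    {Bt : Fin N → Set (Finset V)}
    (hBt : ∀ k, IsRelativeBasis K d (H k) (sectionPoints e k (H k)) (Bt k)) :
    IsRelativeBasis K (d + 1) W E (⋃ k, {σ | ∃ τ ∈ Bt k, IsMu E (e k) τ σ}) := by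
  have heW : ∀ i, e i ∈ W := fun i => hEW (he.range_eq ▸ mem_range_self i)
  refine isRelativeBasis_of_isApex hEW he.range_eq fun k hk => ?_
  obtain ⟨i₀, hi₀⟩ : (Ioi k).Nonempty := by
    rcases hk with hk | ⟨σ, τ, hτ, -⟩
    · exact hk
    · obtain ⟨hτP, hτc, -⟩ := (hBt k).subset hτ
      obtain ⟨p, hp⟩ := Finset.card_pos.mp (by rw [hτc]; omega : 0 < τ.card)
      obtain ⟨-, i, hi, -⟩ := hτP hp
      exact ⟨i, hi⟩
  have hopp : ∀ i, k < i → (H k).SOppSide (e k) (e i) := fun i hi =>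
    hsep k _ (subset_convexHull ℝ _ (mem_image_of_mem e self_mem_Iic)) _
      (subset_convexHull ℝ _ (mem_image_of_mem e (mem_Ioi.mpr hi)))
  obtain ⟨p, hp, -⟩ := (hopp i₀ hi₀).exists_sbtw
  have hxH : e k ∉ H k := (hopp i₀ hi₀).2.1
  have hpx : p - e k ∉ (H k).direction := fun h => hxH (by
    have := AffineSubspace.vadd_mem_of_mem_direction ((H k).direction.neg_mem h) hp
    simpa using this)
  -- `ψ` is constant on `H k` and takes another value at `e k`; normalising it gives an equation of
  -- `H k` inside `W`.
  obtain ⟨ψ, hψ, hker⟩ := Submodule.exists_le_ker_of_notMem hpx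
  set φ : V →ₗ[ℝ] ℝ := (ψ (p - e k))⁻¹ • ψ with hφdef
  have hφH : ∀ z ∈ H k, φ (z - e k) = 1 := by
    intro z hz
    have h0 : ψ (z - p) = 0 := hker ((H k).vsub_mem_direction hz hp)
    rw [hφdef, LinearMap.smul_apply, ← sub_add_sub_cancel z p (e k), map_add, h0, zero_add,
      smul_eq_mul, inv_mul_cancel₀ hψ]
  have hcross : ∀ i, k < i → ∃ q ∈ H k, ∃ s : ℝ, 0 < s ∧ s < 1 ∧ q = e k + s • (e i - e k) := by
    intro i hi
    obtain ⟨q, hq, hs⟩ := (hopp i hi).exists_sbtw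
    exact ⟨q, hq, (sbtw_iff_exists_add_smul.mp hs).2⟩
  have hproj : ∀ q ∈ H k, ∀ y : V, ∀ s : ℝ, 0 < s → q = e k + s • (y - e k) →
      s * φ (y - e k) = 1 ∧ centralProj (e k) φ y = q := by
    intro q hq y s hs hqs
    have h1 := hφH q hq
    rw [hqs, add_sub_cancel_left, map_smul, smul_eq_mul] at h1
    refine ⟨h1, ?_⟩
    rw [centralProj, hqs, ← eq_inv_of_mul_eq_one_left h1]
  have hφ : ∀ i, k < i → 1 < φ (e i - e k) := by
    intro i hi
    obtain ⟨q, hq, s, hs0, hs1, hqs⟩ := hcross i hi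
    have h1 := (hproj q hq _ s hs0 hqs).1
    by_contra hle
    nlinarith
  have hHmem : ∀ z, z ∈ H k ↔ z ∈ W ∧ φ (z - e k) = 1 := by
    intro z
    refine ⟨fun hz => ⟨hHW k hz, hφH z hz⟩, fun ⟨hzW, hz⟩ => ?_⟩
    -- Both directions have dimension `d`, because `φ` does not vanish on `W.direction`; hence they
    -- coincide.
    have hle : (H k).direction ≤ W.direction ⊓ φ.ker :=
      direction_le_inf_ker fun z hz => ⟨hHW k hz, hφH z hz⟩
    have h2 := Submodule.finrank_lt_finrank_of_lt
      (direction_inf_ker_lt (heW k) (heW i₀) (one_pos.trans (hφ i₀ hi₀)).ne')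
    have heq := Submodule.eq_of_le_of_finrank_le hle (by rw [hH k]; omega)
    have hmem : z - p ∈ (H k).direction := by
      rw [heq]
      refine ⟨W.vsub_mem_direction hzW (hHW k hp), ?_⟩
      have := hφH p hp
      rw [map_sub] at this hz
      change φ (z - p) = 0
      rw [map_sub]
      linarith
    have := AffineSubspace.vadd_mem_of_mem_direction hmem hp
    simpa using this
  obtain ⟨ν, hA, hν⟩ := he.exists_isApex hφ
  have hsection : sectionPoints e k (H k) = centralProj (e k) φ '' (e '' Ioi k) := by
    ext q
    constructor
    · rintro ⟨hq, i, hi, hqi⟩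
      rw [openSegment_eq_image_lineMap] at hqi
      obtain ⟨s, ⟨hs0, -⟩, hs⟩ := hqi
      rw [AffineMap.lineMap_apply, vsub_eq_sub, vadd_eq_add, add_comm] at hs
      exact ⟨e i, mem_image_of_mem e hi, (hproj q hq _ s hs0 hs.symm).2⟩
    · rintro ⟨_, ⟨i, hi, rfl⟩, rfl⟩
      obtain ⟨q, hq, s, hs0, hs1, hqs⟩ := hcross i hi
      rw [(hproj q hq _ s hs0 hqs).2]
      refine ⟨hq, i, hi, ?_⟩
      rw [openSegment_eq_image_lineMap]
      refine ⟨s, ⟨hs0, hs1⟩, ?_⟩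
      rw [AffineMap.lineMap_apply, vsub_eq_sub, vadd_eq_add, add_comm, hqs]
  have hBk := hBt k
  rw [hsection] at hBk
  refine ⟨φ, ν, H k, Bt k, hA, hφ, hHmem, ⟨p, hp⟩, hBk, ?_⟩
  ext σ
  exact exists_congr fun τ => and_congr_right fun hτ =>
    (isMu_iff hν (hBk.subset hτ).1).trans eq_comm

/-- Every output of the algorithm is a basis inside the affine subspace. -/
theorem IsAlgorithmOutput.isRelativeBasis [FiniteDimensional ℝ V] (K : Type*) [Field K] {d : ℕ}
    {W : AffineSubspace ℝ V} {E : Set V} {B : Set (Finset V)} (h : IsAlgorithmOutput d W E B) :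
    IsRelativeBasis K d W E B := by
  induction h with
  | plane W E B hW hEW N e he hB =>
    rw [hB]
    exact isRelativeBasis_plane K hW hEW he
  | step d W E B hW hEW N e he H hHW hH hsep Bt _ hB ih =>
    rw [hB]
    exact isRelativeBasis_step hW hEW he hHW hH hsep ih

end SimplexBasis

theorem mainTheorem1 {V : Type*} [NormedAddCommGroup V] [NormedSpace ℝ V] [FiniteDimensional ℝ V]
    (K : Type*) [Field K] [CharZero K]
    (n : ℕ) (hn : 2 ≤ n) (hV : Module.finrank ℝ V = n)
    (E : Set V) (hE : E.Finite) (hN : n < E.ncard)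
    (B : Set (Finset V)) (hB : SimplexBasis.IsAlgorithmOutput n ⊤ E B) :
    SimplexBasis.IsGeometricalBasis K n E (SimplexBasis.systemF n E) B :=
  (hB.isRelativeBasis K).isGeometricalBasis hV hE
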